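/- Let $N\ge 1$ and let $f\in C[0,\infty)\cap C^1(0,\infty)$ satisfy, for every $u>0$, $f(u)>0$, $f'(u)\ge 0$ and $F(u):=\int_u^\infty \frac{d\tau}{f(\tau)}<\infty$. Suppose that the limit $q:=\lim_{u\to\infty}f'(u)F(u)$ exists (these conditions define the class $X_q$). Put $F(0):=\int_0^\infty \frac{d\tau}{f(\tau)}\in(0,\infty]$, and $F(0)^{-r}:=0$ if $F(0)=\infty$. Let $\|\phi\|_{L^1_{\rm ul}}:=\sup_{y\in\mathbb{R}^N}\int_{|x-y|<1}|\phi(x)|\,dx$, let $L^1_{\rm ul}(\mathbb{R}^N)$ be the space of measurable functions for which this norm is finite, and let $\mathcal{L}^1_{\rm ul}(\mathbb{R}^N)$ be the closure in $L^1_{\rm ul}(\mathbb{R}^N)$ of the space $BUC(\mathbb{R}^N)$ of bounded uniformly continuous functions. For $t>0$ let $S(t)\phi(x):=\int_{\mathbb{R}^N}(4\pi t)^{-N/2}e^{-|x-y|^2/(4t)}\phi(y)\,dy$. Let $u_0\ge 0$ be a measurable function on $\mathbb{R}^N$ and let $r\in\mathbb{R}$ be such that one of the following holds: (i) $r>N/2$,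 $q<1+r$ and $F(u_0)^{-r}\in L^1_{\rm ul}(\mathbb{R}^N)$; (ii) $r>N/2$, $q=1+r$, $F(u_0)^{-r}\in L^1_{\rm ul}(\mathbb{R}^N)$, and $f'(u)F(u)\le q$ for all large $u$; (iii) $r=N/2$, $q<1+r$ and $F(u_0)^{-r}\in\mathcal{L}^1_{\rm ul}(\mathbb{R}^N)$. Then the problem $\partial_t u=\Delta u+f(u)$, $u(\cdot,0)=u_0$, on $\mathbb{R}^N$ has a local in time nonnegative solution: there are $T>0$ and a nonnegative function $u\in L^\infty((0,T),L^1_{\rm ul}(\mathbb{R}^N))\cap L^\infty_{\rm loc}((0,T),L^\infty(\mathbb{R}^N))$ such that, for every $t\in(0,T)$ and almost every $x\in\mathbb{R}^N$, $$u(x,t)=S(t)u_0(x)+\int_0^t S(t-s)[f(u(s))](x)\,ds<\infty .$$ Moreover, $u$ can be chosen such that there is $C>0$ with $\|F(u(t))^{-r}\|_{L^1_{\rm ul}}\le C$ for all $0<t<T$. -/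

import Mathlib

open Set Filter Topology MeasureTheory
open scoped ENNReal

namespace SemilinearHeat

noncomputable section

/-- The space `ℝ^N` with its Euclidean norm and Lebesgue measure. -/
abbrev Space (N : ℕ) : Type := EuclideanSpace ℝ (Fin N)

/-- `F(u) = ∫_u^∞ dτ / f(τ)`, with values in `[0, ∞]`. -/
def tailF (f : ℝ → ℝ) (u : ℝ) : ℝ≥0∞ :=
  ∫⁻ τ in Ioi u, (ENNReal.ofReal (f τ))⁻¹

/-- The real number `F(u)^{-r}` for `r > 0`.  The power is taken in `[0, ∞]`, so that it is `0`
where `F(u) = ∞` (which can happen only at `u = 0` for the functions `f` considered below). -/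
def tailFPow (f : ℝ → ℝ) (r : ℝ) (u : ℝ) : ℝ :=
  (tailF f u ^ (-r)).toReal

/-- The class `X_q` for a finite `q`: `f ∈ C[0,∞) ∩ C¹(0,∞)`, `f > 0`, `f' ≥ 0` and `F < ∞` on
`(0,∞)`, and `f'(u) F(u) → q` as `u → ∞`.  Only the values of `f` on `[0,∞)` matter. -/
structure MemX (q : ℝ) (f : ℝ → ℝ) : Prop where
  continuousOn : ContinuousOn f (Ici 0)
  contDiffOn : ContDiffOn ℝ 1 f (Ioi 0)
  pos : ∀ u : ℝ, 0 < u → 0 < f u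
  deriv_nonneg : ∀ u : ℝ, 0 < u → 0 ≤ deriv f u
  tailF_lt_top : ∀ u : ℝ, 0 < u → tailF f u < ∞
  tendsto : Tendsto (fun u : ℝ => deriv f u * (tailF f u).toReal) atTop (𝓝 q)

/-- The uniformly local norm `sup_y ∫_{B(y,1)} |φ(x)| dx`, with values in `[0, ∞]`. -/
def ulNorm {N : ℕ} (φ : Space N → ℝ) : ℝ≥0∞ :=
  ⨆ y : Space N, ∫⁻ x in Metric.ball y 1, ‖φ x‖ₑ

/-- `φ ∈ L¹_ul(ℝ^N)`. -/
def MemL1ul {N : ℕ} (φ : Space N → ℝ) : Prop :=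
  AEStronglyMeasurable φ volume ∧ ulNorm φ < ∞

/-- `φ` belongs to the closure of `BUC(ℝ^N)` in `L¹_ul(ℝ^N)`. -/
def MemClosureBUC {N : ℕ} (φ : Space N → ℝ) : Prop :=
  MemL1ul φ ∧ ∀ ε : ℝ≥0∞, 0 < ε →
    ∃ g : Space N → ℝ, UniformContinuous g ∧ (∃ M : ℝ, ∀ x, |g x| ≤ M) ∧
      ulNorm (fun x => φ x - g x) < ε

/-- The heat kernel `K(x,y,t) = (4πt)^{-N/2} exp(-|x-y|²/(4t))`. -/
def heatKernel {N : ℕ} (x y : Space N) (t : ℝ) : ℝ :=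
  (4 * Real.pi * t) ^ (-(N : ℝ) / 2) * Real.exp (-‖x - y‖ ^ 2 / (4 * t))

/-- `S(t)[φ](x) = ∫ K(x,y,t) φ(y) dy` for a nonnegative function `φ`, with values in `[0, ∞]`. -/
def heatS {N : ℕ} (t : ℝ) (φ : Space N → ℝ) (x : Space N) : ℝ≥0∞ :=
  ∫⁻ y, ENNReal.ofReal (heatKernel x y t) * ENNReal.ofReal (φ y)

/-- The right-hand side `S(t)u₀ + ∫_0^t S(t-s) f(u(s)) ds` of the integral equation at `(x,t)`,
for nonnegative `u₀`, `u` and `f`, with values in `[0, ∞]`. -/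
def duhamel {N : ℕ} (f : ℝ → ℝ) (u₀ : Space N → ℝ) (u : ℝ → Space N → ℝ) (t : ℝ) (x : Space N) :
    ℝ≥0∞ :=
  heatS t u₀ x + ∫⁻ s in Ioo 0 t, heatS (t - s) (fun y => f (u s y)) x

/-- `u` is a nonnegative solution on `ℝ^N × (0,T)` of `∂ₜu = Δu + f(u)`, `u(0) = u₀`. -/
structure IsNonnegSolution {N : ℕ} (f : ℝ → ℝ) (u₀ : Space N → ℝ) (T : ℝ)
    (u : ℝ → Space N → ℝ) : Prop where
  nonneg : ∀ t ∈ Ioo 0 T, ∀ x, 0 ≤ u t x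
  /-- `u` is measurable on `(0,T) × ℝ^N`. -/
  aemeasurable : AEMeasurable (fun p : ℝ × Space N => u p.1 p.2)
    ((volume.restrict (Ioo 0 T)).prod volume)
  /-- `t ↦ u(t)` is strongly measurable as a map into `L^∞(ℝ^N)`, and hence also as a map into
  `L¹_ul(ℝ^N)`, in which `L^∞(ℝ^N)` is continuously embedded. -/
  stronglyMeasurable : ∃ U : ℝ → Lp ℝ ∞ (volume : Measure (Space N)),
    AEStronglyMeasurable U (volume.restrict (Ioo 0 T)) ∧ ∀ t ∈ Ioo 0 T, ⇑(U t) =ᵐ[volume] u t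
  /-- `u ∈ L^∞((0,T), L¹_ul)`. -/
  bounded_L1ul : ∃ C : ℝ, ∀ t ∈ Ioo 0 T, ulNorm (u t) ≤ ENNReal.ofReal C
  /-- `u ∈ L^∞_loc((0,T), L^∞)`. -/
  locally_bounded : ∀ a b : ℝ, 0 < a → b < T →
    ∃ C : ℝ, ∀ t ∈ Icc a b, eLpNorm (u t) ∞ volume ≤ ENNReal.ofReal C
  /-- The integral equation; its right-hand side is finite since its left-hand side is. -/
  eq_duhamel : ∀ t ∈ Ioo 0 T, ∀ᵐ x ∂(volume : Measure (Space N)),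
    ENNReal.ofReal (u t x) = duhamel f u₀ u t x

end

end SemilinearHeat

/-! The solution is caught below an explicit supersolution `v(s) = F⁻¹(a(s) w(s)^{-1/r} - b(s))`,
where `w(s) = S(s)g` is the heat flow of `g = F(u₀)^{-r} + F(u₁)^{-r}` and `u₁` is so large that the
condition on `f' F` holds beyond it. Adding `F(u₁)^{-r}` keeps the argument of `F⁻¹` in `(0,
F(u₁)]`.

Two facts make `v` a supersolution. First, `u ↦ (F(u) + b)^{-r}` is increasing, and convex where
`f'(F + b) ≤ 1 + r` (`MemX.tangent_le`), so `y ↦ F⁻¹(a y^{-1/r} - b)` is concave there and Jensen's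
inequality for the heat kernel (`heatOp_profile_le`) gives `S(h)[profile(w(s))] ≤ profile(w(s+h))`.
Secondly, the flow of `u' = f(u)` lowers `F(u)` at unit speed; hence if `a` decreases and `b`
increases so that the argument of `F⁻¹` drops by at least `h` in time `h`, then `v(s+h) ≥ S(h)[v(s)
+ h f(v(s))]`. By `duhamel_le_of_step` this infinitesimal inequality integrates to Duhamel's: `s ↦
S(t-s)v(s)(x)` is monotone, its derivative dominates `S(t-s)f(v(s))(x)` almost everywhere, and the
integral of the derivative of a monotone function is at most its increment.

If `r > N/2`, then `w ≤ D t^{-N/2}` gives `w^{-1/r} ≥ c t^θ` with `θ = N/(2r) < 1`, and `b = 0`, `a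
= 1 - A s^{1-θ}` works. If `r = N/2`, then `θ = 1` and this `a` is lost; instead `a = 1`, `b(s) =
s`, paid for by the gap in `q < 1 + r` and by the improved smoothing `w = o(t^{-N/2})` for data in
the closure of `BUC`.

Monotone Picard iteration below `v` yields the solution, and `F(v)^{-r} ≤ K w` transfers the bounds
of the heat flow to it. -/

namespace SemilinearHeat

/-! ### The tail integral `F` and the convexity of its negative powers. -/

/-- The real value of `F(u)`. -/
noncomputable def tailR (f : ℝ → ℝ) (u : ℝ) : ℝ := (tailF f u).toReal

theorem tailFPow_eq (f : ℝ → ℝ) (r u : ℝ) : tailFPow f r u = tailR f u ^ (-r) := by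
  rw [tailFPow, tailR, ENNReal.toReal_rpow]

namespace MemX

variable {q : ℝ} {f : ℝ → ℝ}

theorem hasDerivAt (hf : MemX q f) {u : ℝ} (hu : 0 < u) : HasDerivAt f (deriv f u) u :=
  (((hf.contDiffOn.differentiableOn (by norm_num)) u hu).differentiableAt
    (Ioi_mem_nhds hu)).hasDerivAt

theorem monotoneOn (hf : MemX q f) : MonotoneOn f (Ici 0) := by
  refine monotoneOn_of_deriv_nonneg (convex_Ici 0) hf.continuousOn ?_ ?_
  · rw [interior_Ici]
    exact fun u hu => (hf.hasDerivAt hu).differentiableAt.differentiableWithinAt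
  · rw [interior_Ici]
    exact fun u hu => hf.deriv_nonneg u hu

theorem nonneg (hf : MemX q f) {u : ℝ} (hu : 0 ≤ u) : 0 ≤ f u := by
  have h : ContinuousWithinAt f (Ioi 0) 0 :=
    (hf.continuousOn 0 self_mem_Ici).mono Ioi_subset_Ici_self
  have h0 : 0 ≤ f 0 := ge_of_tendsto h (by
    filter_upwards [self_mem_nhdsWithin] with v hv using (hf.pos v hv).le)
  exact h0.trans (hf.monotoneOn self_mem_Ici hu hu)

theorem continuousOn_inv (hf : MemX q f) : ContinuousOn (fun τ => (f τ)⁻¹) (Ioi 0) :=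
  ContinuousOn.inv₀ (hf.continuousOn.mono Ioi_subset_Ici_self) fun u hu => (hf.pos u hu).ne'

theorem tailF_eq (hf : MemX q f) {u : ℝ} (hu : 0 < u) :
    tailF f u = ∫⁻ τ in Ioi u, ENNReal.ofReal ((f τ)⁻¹) :=
  setLIntegral_congr_fun measurableSet_Ioi fun τ hτ =>
    (ENNReal.ofReal_inv_of_pos (hf.pos τ (hu.trans hτ))).symm

theorem integrableOn_inv (hf : MemX q f) {u : ℝ} (hu : 0 < u) :
    IntegrableOn (fun τ => (f τ)⁻¹) (Ioi u) := by
  have hc : ContinuousOn (fun τ => (f τ)⁻¹) (Ioi u) :=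
    hf.continuousOn_inv.mono (Ioi_subset_Ioi hu.le)
  refine (lintegral_ofReal_ne_top_iff_integrable (hc.aestronglyMeasurable measurableSet_Ioi)
    ?_).1 ?_
  · exact (ae_restrict_iff' measurableSet_Ioi).2 (ae_of_all _ fun τ hτ =>
      (inv_pos.2 (hf.pos τ (hu.trans hτ))).le)
  · rw [← hf.tailF_eq hu]
    exact (hf.tailF_lt_top u hu).ne

theorem tailR_eq (hf : MemX q f) {u : ℝ} (hu : 0 < u) :
    tailR f u = ∫ τ in Ioi u, (f τ)⁻¹ := by
  rw [tailR, hf.tailF_eq hu, integral_eq_lintegral_of_nonneg_ae]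
  · exact (ae_restrict_iff' measurableSet_Ioi).2 (ae_of_all _ fun τ hτ =>
      (inv_pos.2 (hf.pos τ (hu.trans hτ))).le)
  · exact (hf.integrableOn_inv hu).aestronglyMeasurable

theorem tailR_eq_sub (hf : MemX q f) {u v : ℝ} (hu : 0 < u) (hv : 0 < v) :
    tailR f v = tailR f u - ∫ τ in u..v, (f τ)⁻¹ := by
  rw [hf.tailR_eq hu, hf.tailR_eq hv,
    ← intervalIntegral.integral_Ioi_sub_Ioi' (hf.integrableOn_inv hu) (hf.integrableOn_inv hv)]
  ring

theorem hasDerivAt_tailR (hf : MemX q f) {u : ℝ} (hu : 0 < u) :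
    HasDerivAt (tailR f) (-(f u)⁻¹) u := by
  have hc : ContinuousAt (fun τ => (f τ)⁻¹) u :=
    hf.continuousOn_inv.continuousAt (Ioi_mem_nhds hu)
  have h : HasDerivAt (fun v => ∫ τ in u..v, (f τ)⁻¹) ((f u)⁻¹) u :=
    intervalIntegral.integral_hasDerivAt_right (by simp)
      (hf.continuousOn_inv.stronglyMeasurableAtFilter isOpen_Ioi u hu) hc
  have h2 := h.const_sub (tailR f u)
  refine h2.congr_of_eventuallyEq ?_
  filter_upwards [Ioi_mem_nhds hu] with v hv using hf.tailR_eq_sub hu hv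

theorem strictAntiOn_tailR (hf : MemX q f) : StrictAntiOn (tailR f) (Ioi 0) := by
  refine strictAntiOn_of_deriv_neg (convex_Ioi 0)
    (fun u hu => (hf.hasDerivAt_tailR hu).continuousAt.continuousWithinAt) ?_
  rw [interior_Ioi]
  intro u hu
  rw [(hf.hasDerivAt_tailR hu).deriv]
  exact neg_lt_zero.2 (inv_pos.2 (hf.pos u hu))

theorem tailR_pos (hf : MemX q f) {u : ℝ} (hu : 0 < u) : 0 < tailR f u :=
  (ENNReal.toReal_nonneg (a := tailF f (u + 1))).trans_lt
    (hf.strictAntiOn_tailR hu (show 0 < u + 1 by linarith) (by linarith))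

theorem tendsto_tailR (hf : MemX q f) : Tendsto (tailR f) atTop (𝓝 0) := by
  have h := (intervalIntegral_tendsto_integral_Ioi 1 (hf.integrableOn_inv one_pos)
    tendsto_id).const_sub (tailR f 1)
  rw [← hf.tailR_eq one_pos, sub_self] at h
  refine h.congr' ?_
  filter_upwards [Ioi_mem_atTop 0] with v hv using (hf.tailR_eq_sub one_pos hv).symm

/-- `F` maps `[u₁, ∞)` onto `(0, F(u₁)]`. -/
theorem exists_tailR_eq (hf : MemX q f) {u₁ v : ℝ} (hu₁ : 0 < u₁) (hv : 0 < v)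
    (hv' : v ≤ tailR f u₁) : ∃ u, u₁ ≤ u ∧ tailR f u = v := by
  obtain ⟨U, hU, hU'⟩ := ((hf.tendsto_tailR.eventually (gt_mem_nhds hv)).and
    (eventually_ge_atTop u₁)).exists
  have hc : ContinuousOn (tailR f) (Icc u₁ U) := fun u hu =>
    (hf.hasDerivAt_tailR (hu₁.trans_le hu.1)).continuousAt.continuousWithinAt
  obtain ⟨u, hu, h⟩ := intermediate_value_Icc' hU' hc ⟨hU.le, hv'⟩
  exact ⟨u, hu.1, h⟩

theorem le_of_tailR_le (hf : MemX q f) {u v : ℝ} (hu : 0 < u) (hv : 0 < v)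
    (h : tailR f u ≤ tailR f v) : v ≤ u :=
  (hf.strictAntiOn_tailR.le_iff_ge hu hv).1 h

theorem tailR_le (hf : MemX q f) {u v : ℝ} (hu : 0 < u) (h : u ≤ v) : tailR f v ≤ tailR f u :=
  hf.strictAntiOn_tailR.antitoneOn hu (hu.trans_le h) h

/-- Following the flow of `u' = f(u)` for time `h` increases `u` by at least `h f(u)`. -/
theorem add_mul_le_of_tailR (hf : MemX q f) {u v h : ℝ} (hu : 0 < u) (hv : 0 < v) (hh : 0 ≤ h)
    (huv : h ≤ tailR f u - tailR f v) : u + h * f u ≤ v := by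
  have huv' : u ≤ v := hf.le_of_tailR_le hv hu (by linarith)
  rw [hf.tailR_eq_sub hu hv] at huv
  -- Since `f` is nondecreasing, `F(u) - F(v) ≤ (v - u) / f(u)`.
  have hle : ∫ τ in u..v, (f τ)⁻¹ ≤ ∫ τ in u..v, (f u)⁻¹ := by
    refine intervalIntegral.integral_mono_on huv' ?_ (by simp) ?_
    · rw [intervalIntegrable_iff_integrableOn_Ioc_of_le huv']
      exact (hf.integrableOn_inv hu).mono_set Ioc_subset_Ioi_self
    · intro τ hτ
      have := hf.monotoneOn hu.le (hu.le.trans hτ.1) hτ.1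
      exact inv_anti₀ (hf.pos u hu) this
  rw [intervalIntegral.integral_const, smul_eq_mul] at hle
  have hfu := hf.pos u hu
  have : h ≤ (v - u) * (f u)⁻¹ := by linarith
  rw [← div_eq_mul_inv, le_div_iff₀ hfu] at this
  linarith

/-- The tangent line inequality for the function `u ↦ (F(u) + b)^{-r}`, which is convex where
`f'(u) (F(u) + b) ≤ 1 + r`. -/
theorem tangent_le (hf : MemX q f) {r b u v : ℝ} (hr : 0 < r) (hb : 0 ≤ b) (hu : 0 < u)
    (hv : 0 < v) (hconv : ∀ z ∈ uIcc u v, deriv f z * (tailR f z + b) ≤ 1 + r) :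
    (tailR f u + b) ^ (-r) + r * (tailR f u + b) ^ (-r - 1) * (f u)⁻¹ * (v - u)
      ≤ (tailR f v + b) ^ (-r) := by
  have hpos : ∀ z ∈ uIcc u v, 0 < z := fun z hz => (lt_min hu hv).trans_le hz.1
  have hFb : ∀ z ∈ uIcc u v, 0 < tailR f z + b := fun z hz => by
    linarith [hf.tailR_pos (hpos z hz)]
  have hd : ∀ z ∈ uIcc u v, HasDerivAt (fun z => (tailR f z + b) ^ (-r))
      (r * (tailR f z + b) ^ (-r - 1) * (f z)⁻¹) z := fun z hz => by
    have := ((hf.hasDerivAt_tailR (hpos z hz)).add_const b).rpow_const (p := -r)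
      (Or.inl (hFb z hz).ne')
    convert this using 1
    ring
  -- The derivative of `(F + b)^{-r}` is `r` divided by this function, whose own derivative has the
  -- sign of `f'(F + b) - (1 + r)`.
  have hH : AntitoneOn (fun z => f z * (tailR f z + b) ^ (r + 1)) (uIcc u v) := by
    have hdH : ∀ z ∈ uIcc u v, HasDerivAt (fun z => f z * (tailR f z + b) ^ (r + 1))
        ((tailR f z + b) ^ r * (deriv f z * (tailR f z + b) - (1 + r))) z := fun z hz => by
      have h1 := ((hf.hasDerivAt_tailR (hpos z hz)).add_const b).rpow_const (p := r + 1)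
        (Or.inl (hFb z hz).ne')
      have h2 := (hf.hasDerivAt (hpos z hz)).mul h1
      refine h2.congr_deriv ?_
      rw [Real.rpow_add_one (hFb z hz).ne', add_sub_cancel_right]
      have := (hf.pos z (hpos z hz)).ne'
      field_simp
      ring
    refine antitoneOn_of_deriv_nonpos (convex_uIcc u v)
      (fun z hz => (hdH z hz).continuousAt.continuousWithinAt)
      (fun z hz => (hdH z (interior_subset hz)).differentiableAt.differentiableWithinAt)
      fun z hz => ?_
    rw [(hdH z (interior_subset hz)).deriv]
    exact mul_nonpos_of_nonneg_of_nonpos (Real.rpow_nonneg (hFb z (interior_subset hz)).le _)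
      (by linarith [hconv z (interior_subset hz)])
  have hform : ∀ z ∈ uIcc u v, r * (tailR f z + b) ^ (-r - 1) * (f z)⁻¹
      = r * (f z * (tailR f z + b) ^ (r + 1))⁻¹ := fun z hz => by
    rw [show -r - 1 = -(r + 1) by ring, Real.rpow_neg (hFb z hz).le, mul_inv]
    ring
  have hcx : ConvexOn ℝ (uIcc u v) (fun z => (tailR f z + b) ^ (-r)) := by
    refine MonotoneOn.convexOn_of_deriv (convex_uIcc u v)
      (fun z hz => (hd z hz).continuousAt.continuousWithinAt)
      (fun z hz => (hd z (interior_subset hz)).differentiableAt.differentiableWithinAt) ?_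
    intro z hz z' hz' hzz'
    have hz := interior_subset hz
    have hz' := interior_subset hz'
    rw [(hd z hz).deriv, (hd z' hz').deriv, hform z hz, hform z' hz']
    refine mul_le_mul_of_nonneg_left (inv_anti₀ ?_ (hH hz hz' hzz')) hr.le
    exact mul_pos (hf.pos z' (hpos z' hz')) (Real.rpow_pos_of_pos (hFb z' hz') _)
  have hu' : u ∈ uIcc u v := left_mem_uIcc
  have hv' : v ∈ uIcc u v := right_mem_uIcc
  rcases lt_trichotomy u v with h | h | h
  · have := hcx.le_slope_of_hasDerivAt hu' hv' h (hd u hu')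
    rw [slope_def_field, le_div_iff₀ (by linarith)] at this
    linarith
  · subst h; simp
  · have := hcx.slope_le_of_hasDerivAt hv' hu' h (hd u hu')
    rw [slope_def_field, div_le_iff₀ (by linarith)] at this
    linarith

theorem tailFPow_mono (hf : MemX q f) {u v r : ℝ} (hr : 0 ≤ r) (hv : 0 < v) (h : u ≤ v) :
    tailFPow f r u ≤ tailFPow f r v := by
  have h1 : tailF f v ≤ tailF f u := lintegral_mono_set (Ioi_subset_Ioi h)
  have h2 : tailF f v ≠ 0 := fun h0 => (hf.tailR_pos hv).ne' (by simp [tailR, h0])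
  refine ENNReal.toReal_mono ?_ ?_
  · simp only [ne_eq, ENNReal.rpow_eq_top_iff, h2, (hf.tailF_lt_top v hv).ne, false_and, or_self,
      not_false_eq_true]
  · rw [ENNReal.rpow_neg, ENNReal.rpow_neg]
    exact ENNReal.inv_le_inv.2 (ENNReal.rpow_le_rpow h1 hr)

end MemX

/-! ### The heat semigroup on `[0, ∞]`-valued functions. -/

section HeatSemigroup

variable {N : ℕ}

/-- The heat semigroup on functions with values in `[0, ∞]`. -/
noncomputable def heatOp (t : ℝ) (φ : Space N → ℝ≥0∞) (x : Space N) : ℝ≥0∞ :=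
  ∫⁻ y, ENNReal.ofReal (heatKernel x y t) * φ y

theorem heatKernel_pos (x y : Space N) {t : ℝ} (ht : 0 < t) : 0 < heatKernel x y t :=
  mul_pos (Real.rpow_pos_of_pos (by positivity) _) (Real.exp_pos _)

theorem heatKernel_comm (x y : Space N) (t : ℝ) : heatKernel x y t = heatKernel y x t := by
  rw [heatKernel, heatKernel, norm_sub_rev]

theorem measurable_heatKernel :
    Measurable fun p : Space N × Space N × ℝ => heatKernel p.1 p.2.1 p.2.2 := by
  unfold heatKernel
  fun_prop

theorem measurable_ofReal_heatKernel (x : Space N) (t : ℝ) :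
    Measurable fun y => ENNReal.ofReal (heatKernel x y t) :=
  (measurable_heatKernel.comp
    (measurable_const.prodMk (measurable_id.prodMk measurable_const))).ennreal_ofReal

theorem integral_heatKernel (x : Space N) {t : ℝ} (ht : 0 < t) :
    ∫ y, heatKernel x y t = 1 := by
  have h1 : ∫ y, heatKernel x y t = (4 * Real.pi * t) ^ (-(N : ℝ) / 2) *
      ∫ y : Space N, Real.exp (-(4 * t)⁻¹ * ‖y‖ ^ 2) := by
    rw [← integral_const_mul, ← integral_sub_left_eq_self _ volume x]
    refine integral_congr_ae (ae_of_all _ fun y => ?_)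
    simp only [heatKernel, sub_sub_cancel]
    congr 2
    ring
  rw [h1, GaussianFourier.integral_rexp_neg_mul_sq_norm (by positivity), finrank_euclideanSpace,
    Fintype.card_fin, div_inv_eq_mul, show Real.pi * (4 * t) = 4 * Real.pi * t by ring,
    ← Real.rpow_add (by positivity), show -(N : ℝ) / 2 + (N : ℝ) / 2 = 0 by ring, Real.rpow_zero]

theorem lintegral_heatKernel (x : Space N) {t : ℝ} (ht : 0 < t) :
    ∫⁻ y, ENNReal.ofReal (heatKernel x y t) = 1 := by
  have hi : Integrable fun y => heatKernel x y t := by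
    by_contra h
    have := integral_undef h
    rw [integral_heatKernel x ht] at this
    exact one_ne_zero this
  rw [← ofReal_integral_eq_lintegral_ofReal hi (ae_of_all _ fun y => (heatKernel_pos x y ht).le),
    integral_heatKernel x ht, ENNReal.ofReal_one]

/-- Completing the square in `z`: as a function of `z` the product is a Gaussian about a weighted
mean of `x` and `y`, so that integrating in `z` needs only the total mass. -/
theorem heatKernel_mul_heatKernel (x y z : Space N) {s t : ℝ} (hs : 0 < s) (ht : 0 < t) :
    heatKernel x z t * heatKernel z y s = heatKernel x y (t + s) *
      heatKernel ((t + s)⁻¹ • (s • x + t • y)) z (t * s / (t + s)) := by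
  have hts : 0 < t + s := by positivity
  have h1 : (4 * Real.pi * t) ^ (-(N : ℝ) / 2) * (4 * Real.pi * s) ^ (-(N : ℝ) / 2)
      = (4 * Real.pi * (t + s)) ^ (-(N : ℝ) / 2) *
        (4 * Real.pi * (t * s / (t + s))) ^ (-(N : ℝ) / 2) := by
    rw [← Real.mul_rpow (by positivity) (by positivity),
      ← Real.mul_rpow (by positivity) (by positivity)]
    congr 1
    field_simp
  have h2 : ((t + s)⁻¹ • (s • x + t • y)) - z = (t + s)⁻¹ • (s • (x - z) - t • (z - y)) := by
    have : z = (t + s)⁻¹ • ((t + s) • z) := by rw [smul_smul, inv_mul_cancel₀ hts.ne', one_smul]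
    conv_lhs => rw [this]
    rw [← smul_sub]
    congr 1
    module
  have h3 : x - y = (x - z) + (z - y) := by abel
  have h4 : -‖x - z‖ ^ 2 / (4 * t) + -‖z - y‖ ^ 2 / (4 * s) = -‖x - y‖ ^ 2 / (4 * (t + s)) +
      -‖((t + s)⁻¹ • (s • x + t • y)) - z‖ ^ 2 / (4 * (t * s / (t + s))) := by
    rw [h2, h3]
    generalize x - z = p
    generalize z - y = p'
    rw [norm_smul, mul_pow, norm_sub_sq_real, norm_add_sq_real, norm_smul, norm_smul,
      real_inner_smul_left, real_inner_smul_right, Real.norm_of_nonneg hs.le,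
      Real.norm_of_nonneg ht.le, Real.norm_of_nonneg (inv_nonneg.2 hts.le)]
    field_simp
    ring
  simp only [heatKernel]
  rw [mul_mul_mul_comm, h1, ← Real.exp_add, h4, Real.exp_add, mul_mul_mul_comm]

theorem measurable_heatOp_comp {α : Type*} [MeasurableSpace α] {τ : α → ℝ} {ξ : α → Space N}
    {φ : α → Space N → ℝ≥0∞} (hτ : Measurable τ) (hξ : Measurable ξ)
    (hφ : Measurable (Function.uncurry φ)) :
    Measurable fun a => heatOp (τ a) (φ a) (ξ a) := by
  refine Measurable.lintegral_prod_right' (f := fun p : α × Space N =>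
    ENNReal.ofReal (heatKernel (ξ p.1) p.2 (τ p.1)) * φ p.1 p.2) (Measurable.mul ?_ hφ)
  exact (measurable_heatKernel.comp ((hξ.comp measurable_fst).prodMk
    (measurable_snd.prodMk (hτ.comp measurable_fst)))).ennreal_ofReal

theorem measurable_heatOp {φ : Space N → ℝ≥0∞} (hφ : Measurable φ) (t : ℝ) :
    Measurable (heatOp t φ) :=
  measurable_heatOp_comp measurable_const measurable_id (hφ.comp measurable_snd)

theorem heatOp_mono {φ ψ : Space N → ℝ≥0∞} (h : ∀ y, φ y ≤ ψ y) (t : ℝ) (x : Space N) :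
    heatOp t φ x ≤ heatOp t ψ x :=
  lintegral_mono fun y => mul_le_mul_right (h y) _

theorem heatOp_mono_ae {φ ψ : Space N → ℝ≥0∞} (h : φ ≤ᵐ[volume] ψ) (t : ℝ) (x : Space N) :
    heatOp t φ x ≤ heatOp t ψ x :=
  lintegral_mono_ae (h.mono fun _ hy => mul_le_mul_right hy _)

theorem heatOp_congr_ae {φ ψ : Space N → ℝ≥0∞} (h : φ =ᵐ[volume] ψ) (t : ℝ) (x : Space N) :
    heatOp t φ x = heatOp t ψ x :=
  le_antisymm (heatOp_mono_ae h.le t x) (heatOp_mono_ae h.symm.le t x)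

theorem heatOp_const (c : ℝ≥0∞) {t : ℝ} (ht : 0 < t) (x : Space N) :
    heatOp t (fun _ => c) x = c := by
  rw [heatOp, lintegral_mul_const _ (measurable_ofReal_heatKernel x t), lintegral_heatKernel x ht,
    one_mul]

theorem heatOp_le {φ : Space N → ℝ≥0∞} {c : ℝ≥0∞} (h : ∀ y, φ y ≤ c) {t : ℝ} (ht : 0 < t)
    (x : Space N) : heatOp t φ x ≤ c :=
  (heatOp_mono h t x).trans_eq (heatOp_const c ht x)

theorem le_heatOp {φ : Space N → ℝ≥0∞} {c : ℝ≥0∞} (h : ∀ y, c ≤ φ y) {t : ℝ} (ht : 0 < t)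
    (x : Space N) : c ≤ heatOp t φ x :=
  (heatOp_const c ht x).symm.trans_le (heatOp_mono h t x)

theorem heatOp_add {φ : Space N → ℝ≥0∞} (hφ : Measurable φ) (ψ : Space N → ℝ≥0∞) (t : ℝ)
    (x : Space N) : heatOp t (fun y => φ y + ψ y) x = heatOp t φ x + heatOp t ψ x := by
  simp only [heatOp, mul_add]
  exact lintegral_add_left ((measurable_ofReal_heatKernel x t).mul hφ) _

theorem heatOp_const_mul {c : ℝ≥0∞} (hc : c ≠ ∞) (φ : Space N → ℝ≥0∞) (t : ℝ) (x : Space N) :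
    heatOp t (fun y => c * φ y) x = c * heatOp t φ x := by
  simp only [heatOp, mul_left_comm _ c]
  exact lintegral_const_mul' _ _ hc

theorem lintegral_heatKernel_mul (x y : Space N) {s t : ℝ} (hs : 0 < s) (ht : 0 < t) :
    ∫⁻ z, ENNReal.ofReal (heatKernel x z t) * ENNReal.ofReal (heatKernel z y s)
      = ENNReal.ofReal (heatKernel x y (t + s)) := by
  have h : ∀ z, ENNReal.ofReal (heatKernel x z t) * ENNReal.ofReal (heatKernel z y s)
      = ENNReal.ofReal (heatKernel x y (t + s)) * ENNReal.ofReal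
        (heatKernel ((t + s)⁻¹ • (s • x + t • y)) z (t * s / (t + s))) := fun z => by
    rw [← ENNReal.ofReal_mul (heatKernel_pos x z ht).le, heatKernel_mul_heatKernel x y z hs ht,
      ENNReal.ofReal_mul (heatKernel_pos x y (by positivity)).le]
  rw [lintegral_congr h, lintegral_const_mul _ (measurable_ofReal_heatKernel _ _),
    lintegral_heatKernel _ (by positivity), mul_one]

/-- The semigroup property. -/
theorem heatOp_heatOp {φ : Space N → ℝ≥0∞} (hφ : Measurable φ) {s t : ℝ} (hs : 0 < s)
    (ht : 0 < t) (x : Space N) : heatOp t (heatOp s φ) x = heatOp (t + s) φ x := by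
  have hK1 : Measurable fun p : Space N × Space N => ENNReal.ofReal (heatKernel x p.1 t) :=
    (measurable_ofReal_heatKernel x t).comp measurable_fst
  have hK2 : Measurable fun p : Space N × Space N => ENNReal.ofReal (heatKernel p.1 p.2 s) :=
    (measurable_heatKernel.comp (measurable_fst.prodMk
        (measurable_snd.prodMk measurable_const))).ennreal_ofReal
  have hφ2 : Measurable fun p : Space N × Space N => φ p.2 := hφ.comp measurable_snd
  have h1 : heatOp t (heatOp s φ) x = ∫⁻ z, ∫⁻ y,
      ENNReal.ofReal (heatKernel x z t) * ENNReal.ofReal (heatKernel z y s) * φ y := by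
    refine lintegral_congr fun z => ?_
    simp only [heatOp, mul_assoc]
    exact (lintegral_const_mul' _ _ ENNReal.ofReal_ne_top).symm
  rw [h1, lintegral_lintegral_swap ((hK1.mul hK2).mul hφ2).aemeasurable]
  refine lintegral_congr fun y => ?_
  have hKy : Measurable fun z =>
      ENNReal.ofReal (heatKernel x z t) * ENNReal.ofReal (heatKernel z y s) :=
    (measurable_ofReal_heatKernel x t).mul (by
      simp only [heatKernel_comm _ y]; exact measurable_ofReal_heatKernel y s)
  rw [lintegral_mul_const _ hKy, lintegral_heatKernel_mul x y hs ht]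

/-- Up to time `t'` the heat kernel decreases by at most the factor `(t/t')^{N/2}`. -/
theorem heatKernel_le_of_le (x y : Space N) {t t' : ℝ} (ht : 0 < t) (htt' : t ≤ t') :
    (t / t') ^ ((N : ℝ) / 2) * heatKernel x y t ≤ heatKernel x y t' := by
  have ht' : 0 < t' := ht.trans_le htt'
  have h1 : (t / t') ^ ((N : ℝ) / 2) * (4 * Real.pi * t) ^ (-(N : ℝ) / 2)
      = (4 * Real.pi * t') ^ (-(N : ℝ) / 2) := by
    rw [neg_div, Real.rpow_neg (by positivity), Real.rpow_neg (by positivity),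
      ← Real.inv_rpow (by positivity), ← Real.inv_rpow (by positivity),
      ← Real.mul_rpow (by positivity) (by positivity)]
    congr 1
    field_simp
  rw [heatKernel, ← mul_assoc, h1, heatKernel]
  refine mul_le_mul_of_nonneg_left (Real.exp_le_exp.2 ?_) (by positivity)
  rw [neg_div, neg_div, neg_le_neg_iff]
  gcongr

/-- The semigroup is Lipschitz continuous in time on bounded nonnegative functions. -/
theorem heatOp_time_le {φ : Space N → ℝ≥0∞} (hφ : Measurable φ) {M : ℝ} (hM : 0 ≤ M)
    (hφM : ∀ y, φ y ≤ ENNReal.ofReal M) {t t' : ℝ} (ht : 0 < t) (htt' : t ≤ t') (x : Space N) :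
    |(heatOp t' φ x).toReal - (heatOp t φ x).toReal| ≤ M * (1 - (t / t') ^ ((N : ℝ) / 2)) := by
  have ht' : 0 < t' := ht.trans_le htt'
  set ρ : ℝ := (t / t') ^ ((N : ℝ) / 2) with hρ
  have hρ0 : 0 ≤ ρ := by positivity
  have hρ1 : ρ ≤ 1 := Real.rpow_le_one (by positivity) ((div_le_one ht').2 htt') (by positivity)
  have hle : ∀ {ψ : Space N → ℝ≥0∞}, Measurable ψ →
      ENNReal.ofReal ρ * heatOp t ψ x ≤ heatOp t' ψ x := fun {ψ} hψ => by
    rw [heatOp, ← lintegral_const_mul' _ _ ENNReal.ofReal_ne_top]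
    refine lintegral_mono fun y => ?_
    rw [← mul_assoc, ← ENNReal.ofReal_mul hρ0]
    exact mul_le_mul_left (ENNReal.ofReal_le_ofReal (heatKernel_le_of_le x y ht htt')) _
  have hb : ∀ {ψ : Space N → ℝ≥0∞} {τ : ℝ}, 0 < τ → (∀ y, ψ y ≤ ENNReal.ofReal M) →
      heatOp τ ψ x ≠ ∞ := fun hτ hψ =>
    ((heatOp_le hψ hτ x).trans_lt ENNReal.ofReal_lt_top).ne
  have hmain : ∀ {ψ : Space N → ℝ≥0∞}, Measurable ψ → (∀ y, ψ y ≤ ENNReal.ofReal M) →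
      ρ * (heatOp t ψ x).toReal ≤ (heatOp t' ψ x).toReal := fun {ψ} hψ hψM => by
    have := ENNReal.toReal_mono (hb ht' hψM) (hle hψ)
    rwa [ENNReal.toReal_mul, ENNReal.toReal_ofReal hρ0] at this
  have h1 := hmain hφ hφM
  -- The kernel comparison bounds `S(t')φ` only from below; applied to `M - φ`, whose flow is `M -
  -- S(t)φ`, it also bounds it from above.
  have hφc : ∀ y, ENNReal.ofReal M - φ y ≤ ENNReal.ofReal M := fun y => tsub_le_self
  have h2 : ρ * (heatOp t (fun y => ENNReal.ofReal M - φ y) x).toReal ≤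
      (heatOp t' (fun y => ENNReal.ofReal M - φ y) x).toReal :=
    hmain (measurable_const.sub hφ) hφc
  have hsum : ∀ {τ : ℝ}, 0 < τ → (heatOp τ φ x).toReal +
      (heatOp τ (fun y => ENNReal.ofReal M - φ y) x).toReal = M := fun {τ} hτ => by
    rw [← ENNReal.toReal_add (hb hτ hφM) (hb hτ hφc), ← heatOp_add hφ]
    simp only [add_tsub_cancel_of_le (hφM _)]
    rw [heatOp_const _ hτ, ENNReal.toReal_ofReal hM]
  have h3 := hsum ht
  have h4 := hsum ht'
  have h5 : 0 ≤ (heatOp t φ x).toReal := ENNReal.toReal_nonneg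
  have h6 : 0 ≤ (heatOp t (fun y => ENNReal.ofReal M - φ y) x).toReal := ENNReal.toReal_nonneg
  rw [abs_le]
  constructor <;> nlinarith

/-- The uniformly local norm of a function with values in `[0, ∞]`. -/
noncomputable def ulNormE (φ : Space N → ℝ≥0∞) : ℝ≥0∞ := ⨆ y : Space N, ∫⁻ x in Metric.ball y 1, φ x

/-- Convolution with a probability density averages translates, and the norm is translation
invariant. -/
theorem ulNormE_heatOp_le {φ : Space N → ℝ≥0∞} (hφ : Measurable φ) {t : ℝ} (ht : 0 < t) :
    ulNormE (heatOp t φ) ≤ ulNormE φ := by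
  refine iSup_le fun c => ?_
  have h0 : ∀ x : Space N, heatOp t φ x
      = ∫⁻ z, ENNReal.ofReal (heatKernel 0 z t) * φ (x - z) := fun x => by
    rw [heatOp, ← lintegral_sub_left_eq_self _ x]
    refine lintegral_congr fun z => ?_
    simp only [heatKernel]
    congr 5
    simp
  simp only [h0]
  rw [lintegral_lintegral_swap]
  · calc ∫⁻ z, ∫⁻ x in Metric.ball c 1, ENNReal.ofReal (heatKernel 0 z t) * φ (x - z)
        ≤ ∫⁻ z, ENNReal.ofReal (heatKernel 0 z t) * ulNormE φ := by
          refine lintegral_mono fun z => ?_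
          dsimp only
          rw [lintegral_const_mul' _ _ ENNReal.ofReal_ne_top]
          refine mul_le_mul_right ?_ _
          refine le_trans (le_of_eq ?_) (le_iSup _ (c - z))
          rw [← lintegral_indicator Metric.isOpen_ball.measurableSet,
            ← lintegral_indicator Metric.isOpen_ball.measurableSet,
            ← lintegral_sub_right_eq_self ((Metric.ball (c - z) 1).indicator φ) z]
          refine lintegral_congr fun x => ?_
          classical
          rw [indicator_apply, indicator_apply, Metric.mem_ball, Metric.mem_ball, dist_sub_right]
      _ = ulNormE φ := by
          rw [lintegral_mul_const _ (measurable_ofReal_heatKernel 0 t), lintegral_heatKernel 0 ht,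
            one_mul]
  · exact (((measurable_ofReal_heatKernel 0 t).comp measurable_snd).mul
      (hφ.comp (measurable_fst.sub measurable_snd))).aemeasurable

/-- The smoothing estimate `‖S(t)φ‖_∞ ≤ C t^{-N/2} ‖φ‖_{L¹_ul}` for `t ≤ 1`. -/
theorem exists_heatOp_le_ulNormE (N : ℕ) : ∃ C : ℝ, 0 < C ∧ ∀ φ : Space N → ℝ≥0∞, Measurable φ →
    ∀ t : ℝ, 0 < t → t ≤ 1 → ∀ x : Space N,
      heatOp t φ x ≤ ENNReal.ofReal (C * t ^ (-(N : ℝ) / 2)) * ulNormE φ := by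
  set V : ℝ := (volume (Metric.ball (0 : Space N) 1)).toReal with hVdef
  have hVtop : volume (Metric.ball (0 : Space N) 1) ≠ ∞ := measure_ball_lt_top.ne
  have hV : 0 < V := ENNReal.toReal_pos (Metric.measure_ball_pos _ _ one_pos).ne' hVtop
  have hvol : ∀ y : Space N, volume (Metric.ball y 1) = ENNReal.ofReal V := fun y => by
    rw [hVdef, ENNReal.ofReal_toReal hVtop, Measure.addHaar_ball_center]
  set D : ℝ := (4 * Real.pi) ^ (-(N : ℝ) / 2) * Real.exp (1 / 4) * V⁻¹
    * (8 * Real.pi) ^ ((N : ℝ) / 2) with hD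
  refine ⟨D, by positivity, fun φ hφ t ht ht1 x => ?_⟩
  set A : ℝ := (4 * Real.pi) ^ (-(N : ℝ) / 2) * t ^ (-(N : ℝ) / 2) * Real.exp (1 / 4) * V⁻¹
    * (8 * Real.pi) ^ ((N : ℝ) / 2) with hA
  have hA0 : 0 ≤ A := by positivity
  -- For `|z - y| < 1` and `t ≤ 1`, `|x-z|²/8 ≤ |x-y|²/(4t) + 1/4`. Averaging over `z` in the unit
  -- ball about `y` and exchanging integrals then leaves unit-ball integrals of `φ` weighted by a
  -- kernel of mass one.
  have hpt : ∀ y z : Space N, z ∈ Metric.ball y 1 → heatKernel x y t ≤ A * V * heatKernel x z 2 := by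
    intro y z hz
    rw [Metric.mem_ball, dist_eq_norm] at hz
    have h1 : A * V * heatKernel x z 2 = (4 * Real.pi * t) ^ (-(N : ℝ) / 2) *
        Real.exp (1 / 4 + -‖x - z‖ ^ 2 / (4 * 2)) := by
      have e1 : (8 * Real.pi) ^ ((N : ℝ) / 2) * (4 * Real.pi * 2) ^ (-(N : ℝ) / 2) = 1 := by
        rw [show 4 * Real.pi * 2 = 8 * Real.pi by ring, ← Real.rpow_add (by positivity),
          show (N : ℝ) / 2 + -(N : ℝ) / 2 = 0 by ring, Real.rpow_zero]
      rw [hA, heatKernel, Real.exp_add, Real.mul_rpow (by positivity) ht.le]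
      calc _ = (4 * Real.pi) ^ (-(N : ℝ) / 2) * t ^ (-(N : ℝ) / 2) * (Real.exp (1 / 4)
            * Real.exp (-‖x - z‖ ^ 2 / (4 * 2))) * (V⁻¹ * V) *
            ((8 * Real.pi) ^ ((N : ℝ) / 2) * (4 * Real.pi * 2) ^ (-(N : ℝ) / 2)) := by ring
        _ = _ := by rw [e1, inv_mul_cancel₀ hV.ne']; ring
    rw [h1, heatKernel]
    refine mul_le_mul_of_nonneg_left (Real.exp_le_exp.2 ?_) (by positivity)
    have h2 : ‖x - z‖ ≤ ‖x - y‖ + ‖z - y‖ := by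
      rw [norm_sub_rev z y]; exact norm_sub_le_norm_sub_add_norm_sub x y z
    have h3 : ‖x - z‖ ^ 2 ≤ 2 * ‖x - y‖ ^ 2 + 2 := by
      nlinarith [norm_nonneg (x - z), norm_nonneg (x - y), norm_nonneg (z - y),
        sq_nonneg (‖x - y‖ - ‖z - y‖)]
    have h4 : ‖x - y‖ ^ 2 / 4 ≤ ‖x - y‖ ^ 2 / (4 * t) := by
      gcongr
      linarith
    rw [neg_div, neg_div]
    linarith
  have hmeas : MeasurableSet {p : Space N × Space N | p.2 ∈ Metric.ball p.1 1} :=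
    measurableSet_lt (measurable_snd.dist measurable_fst) measurable_const
  have hAV : ∀ y, ENNReal.ofReal (heatKernel x y t) ≤ ENNReal.ofReal A *
      ∫⁻ z in Metric.ball y 1, ENNReal.ofReal (heatKernel x z 2) := fun y => by
    have h1 : ENNReal.ofReal (heatKernel x y t) * volume (Metric.ball y 1) ≤
        ENNReal.ofReal (A * V) * ∫⁻ z in Metric.ball y 1, ENNReal.ofReal (heatKernel x z 2) := by
      rw [← setLIntegral_const, ← lintegral_const_mul' _ _ ENNReal.ofReal_ne_top]
      refine setLIntegral_mono' Metric.isOpen_ball.measurableSet fun z hz => ?_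
      rw [← ENNReal.ofReal_mul (by positivity)]
      exact ENNReal.ofReal_le_ofReal (hpt y z hz)
    rw [hvol, mul_comm A V, ENNReal.ofReal_mul hV.le, mul_comm, mul_assoc] at h1
    exact (ENNReal.mul_le_mul_iff_right (ENNReal.ofReal_pos.2 hV).ne' ENNReal.ofReal_ne_top).1 h1
  calc heatOp t φ x
      ≤ ∫⁻ y, ENNReal.ofReal A * ∫⁻ z, (Metric.ball y 1).indicator
          (fun z => ENNReal.ofReal (heatKernel x z 2)) z * φ y := by
        refine lintegral_mono fun y => ?_
        dsimp only
        rw [lintegral_mul_const _ ((measurable_ofReal_heatKernel x 2).indicator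
          Metric.isOpen_ball.measurableSet), ← mul_assoc,
          lintegral_indicator Metric.isOpen_ball.measurableSet]
        exact mul_le_mul_left (hAV y) _
    _ = ENNReal.ofReal A * ∫⁻ z, ∫⁻ y, (Metric.ball y 1).indicator
          (fun z => ENNReal.ofReal (heatKernel x z 2)) z * φ y := by
        rw [lintegral_const_mul' _ _ ENNReal.ofReal_ne_top, lintegral_lintegral_swap]
        refine (Measurable.mul ?_ (hφ.comp measurable_fst)).aemeasurable
        exact ((measurable_ofReal_heatKernel x 2).comp measurable_snd).indicator hmeas
    _ ≤ ENNReal.ofReal A * ∫⁻ z, ENNReal.ofReal (heatKernel x z 2) * ulNormE φ := by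
        refine mul_le_mul_right (lintegral_mono fun z => ?_) _
        dsimp only
        refine le_trans (le_of_eq ?_) (mul_le_mul_right (le_iSup _ z) _)
        rw [← lintegral_indicator Metric.isOpen_ball.measurableSet,
          ← lintegral_const_mul' _ _ ENNReal.ofReal_ne_top]
        refine lintegral_congr fun y => ?_
        classical
        rw [indicator_apply, indicator_apply, Metric.mem_ball, Metric.mem_ball, dist_comm z y]
        split_ifs <;> simp
    _ = ENNReal.ofReal (D * t ^ (-(N : ℝ) / 2)) * ulNormE φ := by
        rw [lintegral_mul_const _ (measurable_ofReal_heatKernel x 2), lintegral_heatKernel x two_pos,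
          one_mul]
        congr 2
        rw [hA, hD]; ring

end HeatSemigroup

/-! ### The concave profile `y ↦ F⁻¹(a y^{-1/r} - b)` and Jensen's inequality. -/

section Profile

open Classical in
/-- The inverse of `F : [u₁, ∞) → (0, F(u₁)]`, extended by `u₁`. -/
noncomputable def invTail (f : ℝ → ℝ) (u₁ v : ℝ) : ℝ :=
  if h : ∃ u, u₁ ≤ u ∧ tailR f u = v then h.choose else u₁

theorem le_invTail (f : ℝ → ℝ) (u₁ v : ℝ) : u₁ ≤ invTail f u₁ v := by
  unfold invTail
  split_ifs with h
  · exact h.choose_spec.1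
  · exact le_rfl

variable {q : ℝ} {f : ℝ → ℝ} {r u₁ δ : ℝ}

theorem MemX.tailR_invTail (hf : MemX q f) (hu₁ : 0 < u₁) {v : ℝ} (hv : 0 < v)
    (hv' : v ≤ tailR f u₁) : tailR f (invTail f u₁ v) = v := by
  have h := hf.exists_tailR_eq hu₁ hv hv'
  rw [invTail, dif_pos h]
  exact h.choose_spec.2

/-- For `c ≥ u₁` the sublevel set at `c` consists of the `v` outside the range of `F`, where the
default `u₁` is taken, and of the `v ≥ F(c)`; for `c < u₁` it is empty. -/
theorem MemX.measurable_invTail (hf : MemX q f) (hu₁ : 0 < u₁) : Measurable (invTail f u₁) := by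
  refine measurable_of_Iic fun c => ?_
  by_cases hc : u₁ ≤ c
  · have : invTail f u₁ ⁻¹' Iic c = (Ioc 0 (tailR f u₁))ᶜ ∪ Ici (tailR f c) := by
      ext v
      simp only [mem_preimage, mem_Iic, mem_union, mem_compl_iff, mem_Ici]
      by_cases hv : v ∈ Ioc 0 (tailR f u₁)
      · have h1 := hf.tailR_invTail hu₁ hv.1 hv.2
        have h2 := le_invTail f u₁ v
        simp only [hv, not_true_eq_false, false_or]
        conv_rhs => rw [← h1]
        exact (hf.strictAntiOn_tailR.le_iff_ge (hu₁.trans_le hc) (hu₁.trans_le h2)).symm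
      · simp only [hv, not_false_eq_true, true_or, iff_true]
        rw [invTail, dif_neg]
        · exact hc
        · rintro ⟨u, hu, rfl⟩
          exact hv ⟨hf.tailR_pos (hu₁.trans_le hu), hf.tailR_le hu₁ hu⟩
    rw [this]
    exact measurableSet_Ioc.compl.union measurableSet_Ici
  · have : invTail f u₁ ⁻¹' Iic c = ∅ := by
      ext v
      simp only [mem_preimage, mem_Iic, mem_empty_iff_false, iff_false, not_le]
      exact (not_le.1 hc).trans_le (le_invTail f u₁ v)
    rw [this]
    exact MeasurableSet.empty

/-- The convexity condition `(1 + δ) f'(u) F(u) ≤ 1 + r` for `u ≥ u₁`. -/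
structure ConvexAbove (f : ℝ → ℝ) (r u₁ δ : ℝ) : Prop where
  r_pos : 0 < r
  u₁_pos : 0 < u₁
  δ_nonneg : 0 ≤ δ
  le : ∀ z, u₁ ≤ z → deriv f z * tailR f z * (1 + δ) ≤ 1 + r

/-- The range of parameters for which `y ↦ F⁻¹(a y^{-1/r} - b)` is concave. -/
structure Admissible (f : ℝ → ℝ) (r u₁ δ a b y : ℝ) : Prop where
  a_pos : 0 < a
  a_le : a ≤ 1
  b_nonneg : 0 ≤ b
  -- With `a ≤ 1` and `b ≥ 0` this keeps `a y^{-1/r} - b` below `F(u₁)`.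
  le_y : tailR f u₁ ^ (-r) ≤ y
  -- Equivalent to `b ≤ δ F(u)` at the value `u` of the profile, whence `f'(F + b) ≤ (1 + δ) f' F ≤
  -- 1 + r` there.
  b_le : b * (1 + δ) ≤ δ * (a * y ^ (-r⁻¹))

/-- The concave function `y ↦ F⁻¹(a y^{-1/r} - b)`. -/
noncomputable def profile (f : ℝ → ℝ) (r u₁ a b y : ℝ) : ℝ := invTail f u₁ (a * y ^ (-r⁻¹) - b)

theorem MemX.measurable_profile (hf : MemX q f) (hu₁ : 0 < u₁) :
    Measurable fun p : ℝ × ℝ × ℝ => profile f r u₁ p.1 p.2.1 p.2.2 :=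
  (hf.measurable_invTail hu₁).comp (by fun_prop)

variable {a b y : ℝ}

theorem Admissible.y_pos (h : Admissible f r u₁ δ a b y) (hf : MemX q f)
    (hc : ConvexAbove f r u₁ δ) : 0 < y :=
  (Real.rpow_pos_of_pos (hf.tailR_pos hc.u₁_pos) _).trans_le h.le_y

theorem Admissible.div_le (h : Admissible f r u₁ δ a b y) (hc : ConvexAbove f r u₁ δ) :
    a * y ^ (-r⁻¹) / (1 + δ) ≤ a * y ^ (-r⁻¹) - b := by
  have := h.b_le
  have hδ := hc.δ_nonneg
  rw [div_le_iff₀ (by linarith)]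
  nlinarith

theorem Admissible.value_pos (h : Admissible f r u₁ δ a b y) (hf : MemX q f)
    (hc : ConvexAbove f r u₁ δ) : 0 < a * y ^ (-r⁻¹) - b := by
  refine lt_of_lt_of_le ?_ (h.div_le hc)
  have hδ := hc.δ_nonneg
  have := Real.rpow_pos_of_pos (h.y_pos hf hc) (-r⁻¹)
  have := h.a_pos
  positivity

theorem Admissible.value_le (h : Admissible f r u₁ δ a b y) (hf : MemX q f)
    (hc : ConvexAbove f r u₁ δ) : a * y ^ (-r⁻¹) - b ≤ tailR f u₁ := by
  have hF := hf.tailR_pos hc.u₁_pos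
  have h1 : y ^ (-r⁻¹) ≤ (tailR f u₁ ^ (-r)) ^ (-r⁻¹) :=
    Real.rpow_le_rpow_of_nonpos (Real.rpow_pos_of_pos hF _) h.le_y
      (by simpa using hc.r_pos.le)
  rw [← Real.rpow_mul hF.le, neg_mul_neg, mul_inv_cancel₀ hc.r_pos.ne', Real.rpow_one] at h1
  have h2 : 0 ≤ y ^ (-r⁻¹) := Real.rpow_nonneg (h.y_pos hf hc).le _
  nlinarith [h.a_le, h.b_nonneg]

theorem Admissible.tailR_profile (h : Admissible f r u₁ δ a b y) (hf : MemX q f)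
    (hc : ConvexAbove f r u₁ δ) : tailR f (profile f r u₁ a b y) = a * y ^ (-r⁻¹) - b :=
  hf.tailR_invTail hc.u₁_pos (h.value_pos hf hc) (h.value_le hf hc)

theorem ConvexAbove.profile_pos (hc : ConvexAbove f r u₁ δ) (a b y : ℝ) :
    0 < profile f r u₁ a b y := hc.u₁_pos.trans_le (le_invTail _ _ _)

theorem Admissible.tailR_profile_add (h : Admissible f r u₁ δ a b y) (hf : MemX q f)
    (hc : ConvexAbove f r u₁ δ) : (tailR f (profile f r u₁ a b y) + b) ^ (-r) = a ^ (-r) * y := by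
  have hy := h.y_pos hf hc
  rw [h.tailR_profile hf hc, sub_add_cancel,
    Real.mul_rpow h.a_pos.le (Real.rpow_nonneg hy.le _), ← Real.rpow_mul hy.le,
    neg_mul_neg, inv_mul_cancel₀ hc.r_pos.ne', Real.rpow_one]

theorem Admissible.b_le_mul (h : Admissible f r u₁ δ a b y) (hf : MemX q f)
    (hc : ConvexAbove f r u₁ δ) : b ≤ δ * tailR f (profile f r u₁ a b y) := by
  rw [h.tailR_profile hf hc]
  linarith [h.b_le]

/-- Subtracting `b` costs at most the factor `1 + δ`, and `a` at most the factor `2`. This passes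
bounds of the heat flow on to `F(v)^{-r}`. -/
theorem Admissible.tailR_profile_rpow_le (h : Admissible f r u₁ δ a b y) (hf : MemX q f)
    (hc : ConvexAbove f r u₁ δ) (ha : 1 / 2 ≤ a) :
    tailR f (profile f r u₁ a b y) ^ (-r) ≤ (2 * (1 + δ)) ^ r * y := by
  have hy := h.y_pos hf hc
  have hδ := hc.δ_nonneg
  have hyr := Real.rpow_pos_of_pos hy (-r⁻¹)
  have h1 : (2 * (1 + δ))⁻¹ * y ^ (-r⁻¹) ≤ tailR f (profile f r u₁ a b y) := by
    rw [h.tailR_profile hf hc]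
    refine le_trans ?_ (h.div_le hc)
    rw [mul_inv, le_div_iff₀ (by linarith)]
    have : (2 : ℝ)⁻¹ * (1 + δ)⁻¹ * y ^ (-r⁻¹) * (1 + δ) = 2⁻¹ * y ^ (-r⁻¹) := by
      field_simp
    rw [this]
    exact mul_le_mul_of_nonneg_right (by linarith) hyr.le
  refine (Real.rpow_le_rpow_of_nonpos (by positivity) h1 (by linarith [hc.r_pos])).trans_eq ?_
  rw [Real.mul_rpow (by positivity) hyr.le, ← Real.rpow_mul hy.le, neg_mul_neg,
    inv_mul_cancel₀ hc.r_pos.ne', Real.rpow_one, Real.rpow_neg (by positivity),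
    Real.inv_rpow (by positivity), inv_inv]

/-- The supporting line of the concave profile at `m`, read off from the tangent of its convex
inverse `a^r (F + b)^{-r}`; the inverse itself is never differentiated. -/
theorem Admissible.tangent (hf : MemX q f) (hc : ConvexAbove f r u₁ δ) {a b m : ℝ}
    (hm : Admissible f r u₁ δ a b m) :
    ∃ d : ℝ, 0 < d ∧ ∀ y, Admissible f r u₁ δ a b y →
      a ^ (-r) * m + d * profile f r u₁ a b y ≤ a ^ (-r) * y + d * profile f r u₁ a b m := by
  set v := profile f r u₁ a b m with hv
  have hv0 : 0 < v := hc.profile_pos _ _ _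
  refine ⟨r * (tailR f v + b) ^ (-r - 1) * (f v)⁻¹, ?_, fun y hy => ?_⟩
  · have h1 : 0 < tailR f v + b := by linarith [hf.tailR_pos hv0, hm.b_nonneg]
    have h2 := hf.pos v hv0
    have h3 := hc.r_pos
    positivity
  · have hu0 := hc.profile_pos a b y
    have := hf.tangent_le hc.r_pos hm.b_nonneg hv0 hu0 fun z hz => by
      have hz1 : u₁ ≤ z := (le_min (le_invTail _ _ _) (le_invTail _ _ _)).trans hz.1
      have hz0 : 0 < z := hc.u₁_pos.trans_le hz1
      -- `F` decreases, so `F(z)` is at least its value at the larger endpoint, where `b ≤ δ F` is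
      -- known.
      have hb : b ≤ δ * tailR f z := by
        rcases le_max_iff.1 hz.2 with h | h
        · exact (hm.b_le_mul hf hc).trans
            (mul_le_mul_of_nonneg_left (hf.tailR_le hz0 h) hc.δ_nonneg)
        · exact (hy.b_le_mul hf hc).trans
            (mul_le_mul_of_nonneg_left (hf.tailR_le hz0 h) hc.δ_nonneg)
      have h1 := hc.le z hz1
      have h2 := hf.deriv_nonneg z hz0
      nlinarith
    rw [hy.tailR_profile_add hf hc, hm.tailR_profile_add hf hc] at this
    linarith

/-- Jensen's inequality for the concave function `profile`. -/
theorem heatOp_profile_le {N : ℕ} (hf : MemX q f) (hc : ConvexAbove f r u₁ δ) {a b m h : ℝ}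
    (hh : 0 < h) {φ : Space N → ℝ} (hφ : Measurable φ)
    (hadm : ∀ y, Admissible f r u₁ δ a b (φ y)) (hm : Admissible f r u₁ δ a b m) (x : Space N)
    (hφm : heatOp h (fun y => ENNReal.ofReal (φ y)) x = ENNReal.ofReal m) :
    heatOp h (fun y => ENNReal.ofReal (profile f r u₁ a b (φ y))) x
      ≤ ENNReal.ofReal (profile f r u₁ a b m) := by
  obtain ⟨d, hd, htan⟩ := Admissible.tangent hf hc hm
  have ha : 0 < a ^ (-r) := Real.rpow_pos_of_pos hm.a_pos _
  have hm0 := hm.y_pos hf hc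
  have hpt : ∀ y, ENNReal.ofReal (a ^ (-r) * m) +
      ENNReal.ofReal d * ENNReal.ofReal (profile f r u₁ a b (φ y)) ≤
      ENNReal.ofReal (a ^ (-r)) * ENNReal.ofReal (φ y) +
        ENNReal.ofReal (d * profile f r u₁ a b m) := fun y => by
    have hp := hc.profile_pos a b (φ y)
    have hp' := hc.profile_pos a b m
    have hy0 := (hadm y).y_pos hf hc
    rw [← ENNReal.ofReal_mul hd.le, ← ENNReal.ofReal_mul ha.le,
      ← ENNReal.ofReal_add (by positivity) (by positivity),
      ← ENNReal.ofReal_add (by positivity) (by positivity)]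
    exact ENNReal.ofReal_le_ofReal (htan _ (hadm y))
  -- Integrating the supporting line at the mean `m` of `φ` against a kernel of mass one; the terms
  -- `a^{-r} m` then cancel.
  have hint := heatOp_mono hpt h x
  rw [heatOp_add measurable_const, heatOp_add (hφ.ennreal_ofReal.const_mul _),
    heatOp_const _ hh, heatOp_const _ hh, heatOp_const_mul ENNReal.ofReal_ne_top,
    heatOp_const_mul ENNReal.ofReal_ne_top, hφm, ← ENNReal.ofReal_mul ha.le,
    ENNReal.add_le_add_iff_left ENNReal.ofReal_ne_top, ENNReal.ofReal_mul hd.le] at hint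
  exact (ENNReal.mul_le_mul_iff_right (ENNReal.ofReal_pos.2 hd).ne' ENNReal.ofReal_ne_top).1 hint

/-- `F(u)^{-r}` dominates `u`. -/
theorem ConvexAbove.exists_le_add_mul (hf : MemX q f) (hc : ConvexAbove f r u₁ δ) :
    ∃ B : ℝ, 0 ≤ B ∧ ∀ u, u₁ ≤ u → u ≤ u₁ + B * tailR f u ^ (-r) := by
  have hu₁ := hc.u₁_pos
  have hr := hc.r_pos
  have hF := hf.tailR_pos hu₁
  have hf1 := hf.pos u₁ hu₁
  -- The slope at `u₁` of the convex function `F^{-r}`, which lies above its tangent there.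
  set d := r * (tailR f u₁ + 0) ^ (-r - 1) * (f u₁)⁻¹ with hd
  have hd0 : 0 < d := by rw [hd, add_zero]; positivity
  refine ⟨d⁻¹, by positivity, fun u hu => ?_⟩
  have := hf.tangent_le (b := 0) hr le_rfl hu₁ (hu₁.trans_le hu) fun z hz => by
    rw [uIcc_of_le hu] at hz
    have h1 := hc.le z hz.1
    have h2 := hf.deriv_nonneg z (hu₁.trans_le hz.1)
    have h3 := hf.tailR_pos (hu₁.trans_le hz.1)
    have h4 : 0 ≤ deriv f z * tailR f z * δ := mul_nonneg (mul_nonneg h2 h3.le) hc.δ_nonneg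
    rw [add_zero]
    linarith
  rw [← hd, add_zero, add_zero] at this
  have h1 : 0 < tailR f u₁ ^ (-r) := Real.rpow_pos_of_pos hF _
  have h2 : d * (u - u₁) ≤ tailR f u ^ (-r) := by linarith
  rw [inv_mul_eq_div, ← sub_le_iff_le_add', le_div_iff₀ hd0]
  linarith

end Profile

/-! ### From the infinitesimal inequality to a supersolution of the integral equation. -/

section Supersolution

/-- A function `v` with `v(s+h) ≥ S(h)(v(s) + h f(v(s)))` for small `h` is a supersolution of the
integral equation. -/
theorem duhamel_le_of_step {N : ℕ} {g v : ℝ → Space N → ℝ} {u₀ : Space N → ℝ≥0∞} {T : ℝ}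
    (hv : ∀ s, Measurable (v s)) (hg : ∀ s, Measurable (g s)) (hv0 : ∀ s x, 0 ≤ v s x) (hg0 : ∀ s x, 0 ≤ g s x)
    (hinit : ∀ s ∈ Ioo 0 T, ∀ x, heatOp s u₀ x ≤ ENNReal.ofReal (v s x))
    (hu₀ : Measurable u₀)
    (hmono : ∀ s ∈ Ioo 0 T, ∀ h, 0 < h → s + h < T → ∀ x,
      heatOp h (fun y => ENNReal.ofReal (v s y)) x ≤ ENNReal.ofReal (v (s + h) x))
    (hstep : ∀ s ∈ Ioo 0 T, ∀ᶠ h in 𝓝[>] 0, ∀ x,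
      heatOp h (fun y => ENNReal.ofReal (v s y + h * g s y)) x ≤ ENNReal.ofReal (v (s + h) x))
    {t : ℝ} (ht : t ∈ Ioo 0 T) (x : Space N) :
    heatOp t u₀ x + ∫⁻ s in Ioo 0 t, heatOp (t - s) (fun y => ENNReal.ofReal (g s y)) x
      ≤ ENNReal.ofReal (v t x) := by
  set V : ℝ → Space N → ℝ≥0∞ := fun s y => ENNReal.ofReal (v s y) with hV
  have hVm : ∀ s, Measurable (V s) := fun s => (hv s).ennreal_ofReal
  have hle : ∀ s ∈ Ioo 0 t, heatOp (t - s) (V s) x ≤ V t x := fun s hs => by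
    have := hmono s ⟨hs.1, hs.2.trans ht.2⟩ (t - s) (by linarith [hs.2]) (by linarith [ht.2]) x
    simpa [hV] using this
  have hS : heatOp t u₀ x ≤ V t x := hinit t ht x
  have hStop : heatOp t u₀ x ≠ ∞ := (hS.trans_lt ENNReal.ofReal_lt_top).ne
  -- `Φ(s) = S(t-s)v(s)(x)`. The end values are prescribed because `v(0)` is not the datum and
  -- `heatOp 0` need not be the identity; monotonicity is all that is required of them.
  set Φ : ℝ → ℝ := fun s => if s = 0 then (heatOp t u₀ x).toReal else if s = t then v t x
    else (heatOp (t - s) (V s) x).toReal with hΦ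
  have hΦE : ∀ s ∈ Ioo 0 t, ENNReal.ofReal (Φ s) = heatOp (t - s) (V s) x := fun s hs => by
    simp only [hΦ, if_neg hs.1.ne', if_neg hs.2.ne]
    exact ENNReal.ofReal_toReal ((hle s hs).trans_lt ENNReal.ofReal_lt_top).ne
  have hΦ0 : ENNReal.ofReal (Φ 0) = heatOp t u₀ x := by
    simp only [hΦ, if_true]
    exact ENNReal.ofReal_toReal hStop
  have hΦt : Φ t = v t x := by simp [hΦ, ht.1.ne']
  have hΦnn : ∀ s, 0 ≤ Φ s := fun s => by
    simp only [hΦ]; split_ifs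
    · exact ENNReal.toReal_nonneg
    · exact hv0 _ _
    · exact ENNReal.toReal_nonneg
  have hmonoE : ∀ s ∈ Icc 0 t, ∀ s' ∈ Icc 0 t, s ≤ s' → ENNReal.ofReal (Φ s) ≤ ENNReal.ofReal (Φ s') := by
    intro s hs s' hs' hss'
    rcases hss'.eq_or_lt with rfl | hlt
    · exact le_rfl
    rcases hs.1.eq_or_lt with rfl | hs0
    · rcases hs'.2.eq_or_lt with rfl | hst'
      · rw [hΦ0, hΦt]; exact hS
      · rw [hΦ0, hΦE s' ⟨hlt, hst'⟩, show t = (t - s') + s' by ring,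
          ← heatOp_heatOp hu₀ hlt (by linarith), show (t - s') + s' - s' = t - s' by ring]
        exact heatOp_mono (hinit s' ⟨hlt, hst'.trans ht.2⟩) _ _
    · rcases hs'.2.eq_or_lt with rfl | hst'
      · rw [hΦE s ⟨hs0, hlt⟩, hΦt]; exact hle s ⟨hs0, hlt⟩
      · rw [hΦE s ⟨hs0, hlt.trans hst'⟩, hΦE s' ⟨hs0.trans hlt, hst'⟩,
          show t - s = (t - s') + (s' - s) by ring,
          ← heatOp_heatOp (hVm s) (by linarith) (by linarith)]
        refine heatOp_mono (fun y => ?_) _ _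
        have := hmono s ⟨hs0, hlt.trans (hst'.trans ht.2)⟩ (s' - s) (by linarith)
          (by linarith [ht.2]) y
        simpa [hV] using this
  have hΦmono : MonotoneOn Φ (Icc 0 t) := fun s hs s' hs' hss' =>
    (ENNReal.ofReal_le_ofReal_iff (hΦnn s')).1 (hmonoE s hs s' hs' hss')
  have hslope : ∀ s ∈ Ioo 0 t, DifferentiableAt ℝ Φ s →
      heatOp (t - s) (fun y => ENNReal.ofReal (g s y)) x ≤ ENNReal.ofReal (deriv Φ s) := by
    intro s hs hd
    set G := heatOp (t - s) (fun y => ENNReal.ofReal (g s y)) x with hG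
    -- Apply `S(t-s-h)` to the step inequality and use the semigroup property.
    have hev : ∀ᶠ h in 𝓝[>] (0 : ℝ), ENNReal.ofReal (Φ s) + ENNReal.ofReal h * G ≤
        ENNReal.ofReal (Φ (s + h)) := by
      have hsmall : ∀ᶠ h in 𝓝[>] (0 : ℝ), h < t - s :=
        mem_nhdsWithin_of_mem_nhds (Iio_mem_nhds (by linarith [hs.2]))
      filter_upwards [hstep s ⟨hs.1, hs.2.trans ht.2⟩, self_mem_nhdsWithin, hsmall] with h h1 h2 h3
      have h2 : 0 < h := h2
      rw [hΦE s hs, hΦE (s + h) ⟨by linarith [hs.1], by linarith⟩, hG,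
        ← heatOp_const_mul ENNReal.ofReal_ne_top, ← heatOp_add (hVm s)]
      have hm : heatOp (t - s) (fun y => V s y + ENNReal.ofReal h * ENNReal.ofReal (g s y)) x ≤
          heatOp (t - (s + h)) (heatOp h
            fun y => V s y + ENNReal.ofReal h * ENNReal.ofReal (g s y)) x := by
        have hm : Measurable fun y => V s y + ENNReal.ofReal h * ENNReal.ofReal (g s y) :=
          (hVm s).add ((hg s).ennreal_ofReal.const_mul _)
        rw [heatOp_heatOp hm h2 (by linarith), show t - (s + h) + h = t - s by ring]
      refine hm.trans (heatOp_mono (fun y => ?_) _ _)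
      refine le_trans (le_of_eq ?_) (h1 y)
      refine congrArg (fun ψ => heatOp h ψ y) (funext fun z => ?_)
      rw [hV, ← ENNReal.ofReal_mul h2.le, ← ENNReal.ofReal_add (hv0 _ _)
        (mul_nonneg h2.le (hg0 _ _))]
    have hGtop : G ≠ ∞ := by
      obtain ⟨h, h1, h2⟩ := (hev.and self_mem_nhdsWithin).exists
      have h2 : 0 < h := h2
      intro hGt
      rw [hGt, ENNReal.mul_top (ENNReal.ofReal_pos.2 h2).ne', add_top, top_le_iff] at h1
      exact ENNReal.ofReal_ne_top h1
    have hlim := (hasDerivAt_iff_tendsto_slope_zero.1 hd.hasDerivAt).mono_left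
      (nhdsWithin_mono (0 : ℝ) (show Ioi (0 : ℝ) ⊆ {0}ᶜ from fun h hh => (ne_of_gt hh)))
    rw [← ENNReal.ofReal_toReal hGtop]
    refine ENNReal.ofReal_le_ofReal (ge_of_tendsto hlim ?_)
    filter_upwards [hev, self_mem_nhdsWithin] with h h1 h2
    have h2 : 0 < h := h2
    rw [← ENNReal.ofReal_toReal hGtop, ← ENNReal.ofReal_mul h2.le,
      ← ENNReal.ofReal_add (hΦnn s) (mul_nonneg h2.le ENNReal.toReal_nonneg),
      ENNReal.ofReal_le_ofReal_iff (hΦnn _)] at h1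
    rw [smul_eq_mul, inv_mul_eq_div, le_div_iff₀ h2]
    linarith
  have hu : MonotoneOn Φ (uIcc 0 t) := by rwa [uIcc_of_le ht.1.le]
  have hdiff : ∀ᵐ s, s ∈ Ioo 0 t → DifferentiableAt ℝ Φ s := by
    filter_upwards [(hΦmono.mono Ioo_subset_Icc_self).ae_differentiableWithinAt_of_mem] with s hs hst
    exact (hs hst).differentiableAt (Ioo_mem_nhds hst.1 hst.2)
  have hint := hu.intervalIntegrable_deriv
  -- For a monotone function the derivative integrates to at most the increment, so no continuity of
  -- `Φ` is needed.
  have hmem := hu.intervalIntegral_deriv_mem_uIcc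
  have h0t : Φ 0 ≤ Φ t := hΦmono (left_mem_Icc.2 ht.1.le) (right_mem_Icc.2 ht.1.le) ht.1.le
  rw [uIcc_of_le (sub_nonneg.2 h0t)] at hmem
  rw [intervalIntegrable_iff_integrableOn_Ioo_of_le ht.1.le] at hint
  rw [intervalIntegral.integral_of_le ht.1.le, integral_Ioc_eq_integral_Ioo] at hmem
  have hdnn : 0 ≤ᵐ[volume.restrict (Ioo 0 t)] deriv Φ := by
    refine (ae_restrict_iff' measurableSet_Ioo).2 (ae_of_all _ fun s hs => ?_)
    rw [← derivWithin_of_mem_nhds (Icc_mem_nhds hs.1 hs.2)]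
    exact hΦmono.derivWithin_nonneg
  calc heatOp t u₀ x + ∫⁻ s in Ioo 0 t, heatOp (t - s) (fun y => ENNReal.ofReal (g s y)) x
      ≤ heatOp t u₀ x + ∫⁻ s in Ioo 0 t, ENNReal.ofReal (deriv Φ s) := by
        refine add_le_add_right (lintegral_mono_ae ?_) _
        refine (ae_restrict_iff' measurableSet_Ioo).2 ?_
        exact hdiff.mono fun s hs hst => hslope s hst (hs hst)
    _ = ENNReal.ofReal (Φ 0) + ENNReal.ofReal (∫ s in Ioo 0 t, deriv Φ s) := by
        rw [hΦ0, ofReal_integral_eq_lintegral_ofReal hint hdnn]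
    _ ≤ ENNReal.ofReal (Φ 0) + ENNReal.ofReal (Φ t - Φ 0) :=
        add_le_add_right (ENNReal.ofReal_le_ofReal hmem.2) _
    _ = ENNReal.ofReal (v t x) := by
        rw [← ENNReal.ofReal_add (hΦnn 0) (sub_nonneg.2 h0t), hΦt, add_sub_cancel]

/-- The data of a supersolution `F⁻¹(a(s) w(s)^{-1/r} - b(s))`, where `w` solves the heat
equation. -/
structure SuperData {N : ℕ} (f : ℝ → ℝ) (r u₁ δ T : ℝ) (a b : ℝ → ℝ) (w : ℝ → Space N → ℝ) :
    Prop where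
  meas : Measurable (Function.uncurry w)
  meas_a : Measurable a
  meas_b : Measurable b
  heat : ∀ s ∈ Ioo 0 T, ∀ h, 0 < h → s + h < T → ∀ x,
    heatOp h (fun y => ENNReal.ofReal (w s y)) x = ENNReal.ofReal (w (s + h) x)
  half_le : ∀ s ∈ Ioo 0 T, 1 / 2 ≤ a s
  anti : AntitoneOn a (Ioo 0 T)
  mono : MonotoneOn b (Ioo 0 T)
  -- Jensen's inequality with the parameters frozen at `s` involves both `w(s)` and its mean
  -- `w(s+h)`.
  adm : ∀ s ∈ Ioo 0 T, ∀ h, 0 ≤ h → s + h < T → ∀ x,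
    Admissible f r u₁ δ (a s) (b s) (w (s + h) x)
  -- With `w(s)` fixed, advancing the parameters by `h` lowers the argument of `F⁻¹` by at least
  -- `h`, as the flow of `u' = f(u)` does.
  step : ∀ s ∈ Ioo 0 T, ∀ᶠ h in 𝓝[>] 0, ∀ x,
    Admissible f r u₁ δ (a (s + h)) (b (s + h)) (w s x) ∧
      h ≤ (a s - a (s + h)) * w s x ^ (-r⁻¹) + (b (s + h) - b s)

namespace SuperData

variable {N : ℕ} {q : ℝ} {f : ℝ → ℝ} {r u₁ δ T : ℝ} {a b : ℝ → ℝ} {w : ℝ → Space N → ℝ}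

theorem adm_self (hs : SuperData f r u₁ δ T a b w) {s : ℝ} (h : s ∈ Ioo 0 T) (x : Space N) :
    Admissible f r u₁ δ (a s) (b s) (w s x) := by
  simpa using hs.adm s h 0 le_rfl (by simpa using h.2) x

theorem measurable_profile (hs : SuperData f r u₁ δ T a b w) (hf : MemX q f) (hu₁ : 0 < u₁) :
    Measurable fun p : ℝ × Space N => profile f r u₁ (a p.1) (b p.1) (w p.1 p.2) :=
  (hf.measurable_profile hu₁).comp ((hs.meas_a.comp measurable_fst).prodMk
    ((hs.meas_b.comp measurable_fst).prodMk hs.meas))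

/-- Jensen's inequality at the parameters of time `s`; then lowering `a` and raising `b` only
increases the profile. -/
theorem profile_mono (hs : SuperData f r u₁ δ T a b w) (hf : MemX q f)
    (hc : ConvexAbove f r u₁ δ) {s h : ℝ} (hsT : s ∈ Ioo 0 T) (hh : 0 < h) (hshT : s + h < T)
    (x : Space N) :
    heatOp h (fun y => ENNReal.ofReal (profile f r u₁ (a s) (b s) (w s y))) x
      ≤ ENNReal.ofReal (profile f r u₁ (a (s + h)) (b (s + h)) (w (s + h) x)) := by
  have hm := hs.adm s hsT h hh.le hshT x
  have hsh : s + h ∈ Ioo 0 T := ⟨by linarith [hsT.1], hshT⟩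
  have hm' := hs.adm_self hsh x
  refine (heatOp_profile_le hf hc hh (hs.meas.comp measurable_prodMk_left)
    (fun y => hs.adm_self hsT y) hm x (hs.heat s hsT h hh hshT x)).trans
    (ENNReal.ofReal_le_ofReal ?_)
  refine hf.le_of_tailR_le (hc.profile_pos _ _ _) (hc.profile_pos _ _ _) ?_
  rw [hm.tailR_profile hf hc, hm'.tailR_profile hf hc]
  have h1 := hs.anti hsT hsh (by linarith)
  have h2 := hs.mono hsT hsh (by linarith)
  have h3 : 0 ≤ w (s + h) x ^ (-r⁻¹) := Real.rpow_nonneg (hm.y_pos hf hc).le _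
  nlinarith

/-- The reaction step comes first, moving the parameters to time `s + h` at fixed `w(s)`; Jensen's
inequality at the new parameters then moves `w(s)` to `w(s+h)`. -/
theorem profile_step (hs : SuperData f r u₁ δ T a b w) (hf : MemX q f)
    (hc : ConvexAbove f r u₁ δ) {s : ℝ} (hsT : s ∈ Ioo 0 T) :
    ∀ᶠ h in 𝓝[>] 0, ∀ x, heatOp h (fun y => ENNReal.ofReal
        (profile f r u₁ (a s) (b s) (w s y) + h * f (profile f r u₁ (a s) (b s) (w s y)))) x
      ≤ ENNReal.ofReal (profile f r u₁ (a (s + h)) (b (s + h)) (w (s + h) x)) := by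
  have hsmall : ∀ᶠ h in 𝓝[>] (0 : ℝ), h < T - s :=
    mem_nhdsWithin_of_mem_nhds (Iio_mem_nhds (by linarith [hsT.2]))
  filter_upwards [hs.step s hsT, self_mem_nhdsWithin, hsmall] with h h1 h2 h3 x
  have h2 : 0 < h := h2
  have hsh : s + h ∈ Ioo 0 T := ⟨by linarith [hsT.1], by linarith⟩
  refine le_trans (heatOp_mono (fun y => ENNReal.ofReal_le_ofReal ?_) _ _)
    (heatOp_profile_le hf hc h2 (φ := w s) (hs.meas.comp measurable_prodMk_left)
      (fun y => (h1 y).1) (hs.adm_self hsh x) x (hs.heat s hsT h h2 hsh.2 x))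
  have hy := hs.adm_self hsT y
  have hy' := (h1 y).1
  refine hf.add_mul_le_of_tailR (hc.profile_pos _ _ _) (hc.profile_pos _ _ _) h2.le ?_
  rw [hy.tailR_profile hf hc, hy'.tailR_profile hf hc]
  linarith [(h1 y).2]

end SuperData

end Supersolution

/-! ### Monotone Picard iteration below a supersolution. -/

section Iteration

variable {N : ℕ} {q : ℝ} {f : ℝ → ℝ}

/-- Nothing is known of `f` on the negative axis; the truncation makes it usable on the whole line.
-/
theorem MemX.continuous_comp_max (hf : MemX q f) : Continuous fun u => f (max u 0) :=
  hf.continuousOn.comp_continuous (by fun_prop) fun u => le_max_right u 0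

theorem MemX.measurable_comp (hf : MemX q f) {α : Type*} [MeasurableSpace α] {u : α → ℝ}
    (hu : Measurable u) (hu0 : ∀ a, 0 ≤ u a) : Measurable fun a => f (u a) := by
  have := hf.continuous_comp_max.measurable.comp hu
  simpa only [Function.comp_def, max_eq_left (hu0 _)] using this

theorem duhamel_eq (f : ℝ → ℝ) (u₀ : Space N → ℝ) (u : ℝ → Space N → ℝ) (t : ℝ) (x : Space N) :
    duhamel f u₀ u t x = heatOp t (fun y => ENNReal.ofReal (u₀ y)) x +
      ∫⁻ s in Ioo 0 t, heatOp (t - s) (fun y => ENNReal.ofReal (f (u s y))) x := rfl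

theorem measurable_heatOp_sub (hf : MemX q f) {u : ℝ → Space N → ℝ}
    (hu : Measurable (Function.uncurry u)) (hu0 : ∀ t x, 0 ≤ u t x) (t : ℝ) (x : Space N) :
    Measurable fun s => heatOp (t - s) (fun y => ENNReal.ofReal (f (u s y))) x :=
  measurable_heatOp_comp (φ := fun s y => ENNReal.ofReal (f (u s y)))
    (measurable_const.sub measurable_id) measurable_const
    (hf.measurable_comp hu fun p => hu0 p.1 p.2).ennreal_ofReal

theorem measurable_duhamel (hf : MemX q f) {u₀ : Space N → ℝ} (hu₀ : AEMeasurable u₀ volume)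
    {u : ℝ → Space N → ℝ} (hu : Measurable (Function.uncurry u)) (hu0 : ∀ t x, 0 ≤ u t x) :
    Measurable fun p : ℝ × Space N => duhamel f u₀ u p.1 p.2 := by
  simp only [duhamel_eq]
  refine Measurable.add ?_ ?_
  · have h : ∀ p : ℝ × Space N, heatOp p.1 (fun y => ENNReal.ofReal (u₀ y)) p.2
        = heatOp p.1 (fun y => ENNReal.ofReal (hu₀.mk u₀ y)) p.2 := fun p =>
      heatOp_congr_ae (hu₀.ae_eq_mk.fun_comp ENNReal.ofReal) _ _
    simp only [h]
    exact measurable_heatOp_comp (φ := fun _ y => ENNReal.ofReal (hu₀.mk u₀ y)) measurable_fst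
      measurable_snd (hu₀.measurable_mk.ennreal_ofReal.comp measurable_snd)
  · have h1 : Measurable fun p : (ℝ × Space N) × ℝ =>
        heatOp (p.1.1 - p.2) (fun y => ENNReal.ofReal (f (u p.2 y))) p.1.2 := by
      refine measurable_heatOp_comp (τ := fun p : (ℝ × Space N) × ℝ => p.1.1 - p.2)
        (φ := fun p y => ENNReal.ofReal (f (u p.2 y))) (by fun_prop) (by fun_prop) ?_
      have h2 : Measurable fun a : ((ℝ × Space N) × ℝ) × Space N => u a.1.2 a.2 :=
        hu.comp ((measurable_snd.comp measurable_fst).prodMk measurable_snd)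
      exact (hf.measurable_comp h2 fun a => hu0 _ _).ennreal_ofReal
    have hS : MeasurableSet {p : (ℝ × Space N) × ℝ | p.2 ∈ Ioo 0 p.1.1} :=
      (measurableSet_lt measurable_const measurable_snd).inter
        (measurableSet_lt measurable_snd (measurable_fst.comp measurable_fst))
    have h3 := (h1.indicator hS).lintegral_prod_right' (ν := volume)
    convert h3 using 2 with p
    rw [← lintegral_indicator measurableSet_Ioo]
    rfl

theorem duhamel_mono (hf : MemX q f) (u₀ : Space N → ℝ) {u v : ℝ → Space N → ℝ} {t : ℝ}
    (h : ∀ s ∈ Ioo 0 t, ∀ y, 0 ≤ u s y ∧ u s y ≤ v s y) (x : Space N) :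
    duhamel f u₀ u t x ≤ duhamel f u₀ v t x := by
  rw [duhamel_eq, duhamel_eq]
  refine add_le_add_right (setLIntegral_mono' measurableSet_Ioo fun s hs => ?_) _
  refine heatOp_mono (fun y => ENNReal.ofReal_le_ofReal ?_) _ _
  exact hf.monotoneOn (h s hs y).1 ((h s hs y).1.trans (h s hs y).2) (h s hs y).2

/-- The Picard iterates for the integral equation. -/
noncomputable def picard (f : ℝ → ℝ) (u₀ : Space N → ℝ) : ℕ → ℝ → Space N → ℝ
  | 0 => fun _ _ => 0
  | n + 1 => fun t x => (duhamel f u₀ (picard f u₀ n) t x).toReal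

theorem picard_nonneg (f : ℝ → ℝ) (u₀ : Space N → ℝ) (n : ℕ) (t : ℝ) (x : Space N) :
    0 ≤ picard f u₀ n t x := by
  cases n with
  | zero => exact le_rfl
  | succ n => exact ENNReal.toReal_nonneg

theorem measurable_picard (hf : MemX q f) {u₀ : Space N → ℝ} (hu₀ : AEMeasurable u₀ volume)
    (n : ℕ) : Measurable (Function.uncurry (picard f u₀ n)) := by
  induction n with
  | zero => exact measurable_const
  | succ n ih => exact (measurable_duhamel hf hu₀ ih (picard_nonneg f u₀ n)).ennreal_toReal

section Barrier

variable {u₀ : Space N → ℝ} {T : ℝ} {v : ℝ → Space N → ℝ}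

theorem picard_le (hf : MemX q f) (hv0 : ∀ t x, 0 ≤ v t x)
    (hv : ∀ t ∈ Ioo 0 T, ∀ x, duhamel f u₀ v t x ≤ ENNReal.ofReal (v t x)) (n : ℕ) :
    ∀ t ∈ Ioo 0 T, ∀ x, picard f u₀ n t x ≤ v t x := by
  induction n with
  | zero => exact fun t _ x => hv0 t x
  | succ n ih =>
    intro t ht x
    refine ENNReal.toReal_le_of_le_ofReal (hv0 t x) ((duhamel_mono hf u₀ ?_ x).trans (hv t ht x))
    exact fun s hs y => ⟨picard_nonneg f u₀ n s y, ih s ⟨hs.1, hs.2.trans ht.2⟩ y⟩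

/-- The barrier keeps the Duhamel integral finite, so `toReal` in the definition of the iterates
loses nothing. -/
theorem ofReal_picard_succ (hf : MemX q f) (hv0 : ∀ t x, 0 ≤ v t x)
    (hv : ∀ t ∈ Ioo 0 T, ∀ x, duhamel f u₀ v t x ≤ ENNReal.ofReal (v t x)) (n : ℕ)
    {t : ℝ} (ht : t ∈ Ioo 0 T) (x : Space N) :
    ENNReal.ofReal (picard f u₀ (n + 1) t x) = duhamel f u₀ (picard f u₀ n) t x := by
  refine ENNReal.ofReal_toReal (ne_of_lt ?_)
  refine ((duhamel_mono hf u₀ ?_ x).trans (hv t ht x)).trans_lt ENNReal.ofReal_lt_top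
  exact fun s hs y => ⟨picard_nonneg f u₀ n s y, picard_le hf hv0 hv n s ⟨hs.1, hs.2.trans ht.2⟩ y⟩

theorem picard_mono (hf : MemX q f) (hv0 : ∀ t x, 0 ≤ v t x)
    (hv : ∀ t ∈ Ioo 0 T, ∀ x, duhamel f u₀ v t x ≤ ENNReal.ofReal (v t x))
    {t : ℝ} (ht : t ∈ Ioo 0 T) (x : Space N) : Monotone fun n => picard f u₀ n t x := by
  refine monotone_nat_of_le_succ fun n => ?_
  induction n generalizing t x with
  | zero => exact picard_nonneg f u₀ 1 t x
  | succ n ih =>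
    refine (ENNReal.ofReal_le_ofReal_iff (picard_nonneg _ _ _ _ _)).1 ?_
    rw [ofReal_picard_succ hf hv0 hv n ht, ofReal_picard_succ hf hv0 hv (n + 1) ht]
    exact duhamel_mono hf u₀ (fun s hs y =>
      ⟨picard_nonneg f u₀ n s y, ih ⟨hs.1, hs.2.trans ht.2⟩ y⟩) x

/-- Below a supersolution of the integral equation there is a solution. -/
theorem exists_solution_of_supersolution (hf : MemX q f) (hu₀ : AEMeasurable u₀ volume)
    (hv0 : ∀ t x, 0 ≤ v t x)
    (hv : ∀ t ∈ Ioo 0 T, ∀ x, duhamel f u₀ v t x ≤ ENNReal.ofReal (v t x)) :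
    ∃ u : ℝ → Space N → ℝ, Measurable (Function.uncurry u) ∧ (∀ t x, 0 ≤ u t x) ∧
      (∀ t ∈ Ioo 0 T, ∀ x, u t x ≤ v t x) ∧
      ∀ t ∈ Ioo 0 T, ∀ x, ENNReal.ofReal (u t x) = duhamel f u₀ u t x := by
  set p := picard f u₀ with hp
  set u : ℝ → Space N → ℝ := fun t x => (⨆ n, ENNReal.ofReal (p n t x)).toReal with hu
  have hsup : ∀ t ∈ Ioo 0 T, ∀ x, ⨆ n, ENNReal.ofReal (p n t x) ≤ ENNReal.ofReal (v t x) :=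
    fun t ht x => iSup_le fun n => ENNReal.ofReal_le_ofReal (picard_le hf hv0 hv n t ht x)
  have hofu : ∀ t ∈ Ioo 0 T, ∀ x, ENNReal.ofReal (u t x) = ⨆ n, ENNReal.ofReal (p n t x) :=
    fun t ht x => ENNReal.ofReal_toReal ((hsup t ht x).trans_lt ENNReal.ofReal_lt_top).ne
  have hmonoE : ∀ t ∈ Ioo 0 T, ∀ x, Monotone fun n => ENNReal.ofReal (p n t x) :=
    fun t ht x => ENNReal.ofReal_mono.comp (picard_mono hf hv0 hv ht x)
  have hu0 : ∀ t x, 0 ≤ u t x := fun t x => ENNReal.toReal_nonneg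
  have htend : ∀ t ∈ Ioo 0 T, ∀ x, Tendsto (fun n => p n t x) atTop (𝓝 (u t x)) := by
    intro t ht x
    have h1 := tendsto_atTop_iSup (hmonoE t ht x)
    have h2 := (ENNReal.tendsto_toReal
      ((hsup t ht x).trans_lt ENNReal.ofReal_lt_top).ne).comp h1
    refine h2.congr fun n => ?_
    exact ENNReal.toReal_ofReal (picard_nonneg f u₀ n t x)
  have hfmono : ∀ t ∈ Ioo 0 T, ∀ x, Monotone fun n => ENNReal.ofReal (f (p n t x)) :=
    fun t ht x n m hnm => ENNReal.ofReal_le_ofReal (hf.monotoneOn (picard_nonneg f u₀ n t x)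
      (picard_nonneg f u₀ m t x) (picard_mono hf hv0 hv ht x hnm))
  have hfsup : ∀ t ∈ Ioo 0 T, ∀ x, ENNReal.ofReal (f (u t x)) = ⨆ n, ENNReal.ofReal (f (p n t x)) := by
    intro t ht x
    refine tendsto_nhds_unique ?_ (tendsto_atTop_iSup (hfmono t ht x))
    have h1 := (ENNReal.continuous_ofReal.comp hf.continuous_comp_max).tendsto (u t x)
    have h2 := h1.comp (htend t ht x)
    simpa only [Function.comp_def, max_eq_left (hu0 t x), hp,
      max_eq_left (picard_nonneg f u₀ _ t x)] using h2
  have hpm : ∀ n, Measurable (Function.uncurry (p n)) := measurable_picard hf hu₀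
  refine ⟨u, ?_, hu0, fun t ht x => ENNReal.toReal_le_of_le_ofReal (hv0 t x) (hsup t ht x), ?_⟩
  · exact (Measurable.iSup fun n => (hpm n).ennreal_ofReal).ennreal_toReal
  · intro t ht x
    have hin : ∀ s ∈ Ioo 0 t, s ∈ Ioo 0 T := fun s hs => ⟨hs.1, hs.2.trans ht.2⟩
    -- Monotone convergence in space, and below in time, passes to the limit in the recursion.
    have h1 : ∀ s ∈ Ioo 0 t, heatOp (t - s) (fun y => ENNReal.ofReal (f (u s y))) x =
        ⨆ n, heatOp (t - s) (fun y => ENNReal.ofReal (f (p n s y))) x := by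
      intro s hs
      simp only [heatOp, hfsup s (hin s hs), ENNReal.mul_iSup]
      refine lintegral_iSup (fun n => ?_) fun n m hnm y => ?_
      · exact (measurable_ofReal_heatKernel x _).mul (hf.measurable_comp
          ((hpm n).comp measurable_prodMk_left) fun y => picard_nonneg f u₀ n s y).ennreal_ofReal
      · exact mul_le_mul_right (hfmono s (hin s hs) y hnm) _
    rw [hofu t ht, duhamel_eq, setLIntegral_congr_fun measurableSet_Ioo h1, lintegral_iSup',
      ENNReal.add_iSup, ← (hmonoE t ht x).iSup_nat_add 1]
    · exact iSup_congr fun n => ofReal_picard_succ hf hv0 hv n ht x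
    · exact fun n => (measurable_heatOp_sub hf (hpm n) (picard_nonneg f u₀ n) t x).aemeasurable
    · refine (ae_restrict_iff' measurableSet_Ioo).2 (ae_of_all _ fun s hs n m hnm => ?_)
      exact heatOp_mono (fun y => hfmono s (hin s hs) y hnm) _ _

end Barrier

end Iteration

/-! ### Continuity in time with values in `L^∞`. -/

section TimeContinuity

variable {N : ℕ} {q : ℝ} {f : ℝ → ℝ} {u₀ : Space N → ℝ} {T : ℝ} {u : ℝ → Space N → ℝ}

/-- The integral equation started at time `a`. -/
theorem duhamel_restart (hf : MemX q f) (hu₀ : AEMeasurable u₀ volume)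
    (hu : Measurable (Function.uncurry u)) (hu0 : ∀ t x, 0 ≤ u t x)
    (heq : ∀ t ∈ Ioo 0 T, ∀ x, ENNReal.ofReal (u t x) = duhamel f u₀ u t x) {a t : ℝ}
    (ha : 0 < a) (hat : a < t) (htT : t < T) (x : Space N) :
    ENNReal.ofReal (u t x) = heatOp (t - a) (fun y => ENNReal.ofReal (u a y)) x +
      ∫⁻ s in Ico a t, heatOp (t - s) (fun y => ENNReal.ofReal (f (u s y))) x := by
  have hu₀' : ∀ (τ : ℝ) (y : Space N), heatOp τ (fun y => ENNReal.ofReal (u₀ y)) y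
      = heatOp τ (fun y => ENNReal.ofReal (hu₀.mk u₀ y)) y := fun τ y =>
    heatOp_congr_ae (hu₀.ae_eq_mk.fun_comp ENNReal.ofReal) _ _
  have hmk : Measurable fun y => ENNReal.ofReal (hu₀.mk u₀ y) := hu₀.measurable_mk.ennreal_ofReal
  have hfu : ∀ s, Measurable fun y => ENNReal.ofReal (f (u s y)) := fun s =>
    (hf.measurable_comp (hu.comp measurable_prodMk_left) fun y => hu0 s y).ennreal_ofReal
  have hsplit : Ioo 0 t = Ioo 0 a ∪ Ico a t := (Ioo_union_Ico_eq_Ioo ha hat.le).symm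
  -- Tonelli and the semigroup property: the part of the Duhamel integral before time `a` is the one
  -- at time `a`, propagated by `S(t-a)`.
  have hswap : heatOp (t - a) (fun y => ∫⁻ s in Ioo 0 a,
      heatOp (a - s) (fun z => ENNReal.ofReal (f (u s z))) y) x
      = ∫⁻ s in Ioo 0 a, heatOp (t - s) (fun y => ENNReal.ofReal (f (u s y))) x := by
    have hm1 : Measurable fun p : Space N × ℝ =>
        heatOp (a - p.2) (fun z => ENNReal.ofReal (f (u p.2 z))) p.1 := by
      refine measurable_heatOp_comp (τ := fun p : Space N × ℝ => a - p.2)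
        (φ := fun p y => ENNReal.ofReal (f (u p.2 y))) (by fun_prop) (by fun_prop) ?_
      have h2 : Measurable fun b : (Space N × ℝ) × Space N => u b.1.2 b.2 :=
        hu.comp ((measurable_snd.comp measurable_fst).prodMk measurable_snd)
      exact (hf.measurable_comp h2 fun b => hu0 _ _).ennreal_ofReal
    have h1 : heatOp (t - a) (fun y => ∫⁻ s in Ioo 0 a,
        heatOp (a - s) (fun z => ENNReal.ofReal (f (u s z))) y) x = ∫⁻ y, ∫⁻ s in Ioo 0 a,
        ENNReal.ofReal (heatKernel x y (t - a)) *
          heatOp (a - s) (fun z => ENNReal.ofReal (f (u s z))) y :=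
      lintegral_congr fun y => (lintegral_const_mul' _ _ ENNReal.ofReal_ne_top).symm
    rw [h1, lintegral_lintegral_swap]
    · refine setLIntegral_congr_fun measurableSet_Ioo fun s hs => ?_
      have := heatOp_heatOp (hfu s) (s := a - s) (t := t - a) (by linarith [hs.2])
        (by linarith) x
      rwa [show t - a + (a - s) = t - s by ring] at this
    · exact (((measurable_ofReal_heatKernel x _).comp measurable_fst).mul hm1).aemeasurable
  rw [heq t ⟨ha.trans hat, htT⟩, duhamel_eq, hsplit,
    lintegral_union measurableSet_Ico (by
      rw [Set.disjoint_left]; exact fun s hs hs' => absurd hs.2 (not_lt.2 hs'.1)), ← add_assoc]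
  congr 1
  simp only [heq a ⟨ha, hat.trans htT⟩, duhamel_eq, hu₀']
  rw [heatOp_add (measurable_heatOp hmk a), hswap, heatOp_heatOp hmk ha (by linarith),
    show t - a + a = t by ring]

/-- Bounded solutions are continuous in time, uniformly in space. -/
theorem exists_uniform_modulus (hf : MemX q f) (hu₀ : AEMeasurable u₀ volume)
    (hu : Measurable (Function.uncurry u)) (hu0 : ∀ t x, 0 ≤ u t x)
    (heq : ∀ t ∈ Ioo 0 T, ∀ x, ENNReal.ofReal (u t x) = duhamel f u₀ u t x)
    (hbd : ∀ a, 0 < a → ∃ M, ∀ t, a ≤ t → t < T → ∀ x, u t x ≤ M) {t₀ : ℝ} (ht₀ : t₀ ∈ Ioo 0 T)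
    {ε : ℝ} (hε : 0 < ε) : ∀ᶠ t in 𝓝 t₀, ∀ x, |u t x - u t₀ x| ≤ ε := by
  obtain ⟨M', hM'⟩ := hbd (t₀ / 2) (by linarith [ht₀.1])
  set M := max M' 0 with hMdef
  have hM0 : 0 ≤ M := le_max_right _ _
  have hM : ∀ t, t₀ / 2 ≤ t → t < T → ∀ x, u t x ≤ M := fun t h1 h2 x =>
    (hM' t h1 h2 x).trans (le_max_left _ _)
  set Q := f M with hQ
  have hQ0 : 0 ≤ Q := hf.nonneg hM0
  have hfQ : ∀ t, t₀ / 2 ≤ t → t < T → ∀ x, f (u t x) ≤ Q := fun t h1 h2 x =>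
    hf.monotoneOn (hu0 t x) hM0 (hM t h1 h2 x)
  -- The equation is restarted at `a = t₀ - η ≥ t₀ / 2`. For `t < t₀ + η` the reaction since then
  -- contributes at most `2ηQ`, so only the heat flow of the bounded function `u(a)` has to be
  -- compared in time.
  obtain ⟨η, hη0, hη1, hη2⟩ : ∃ η, 0 < η ∧ η ≤ t₀ / 2 ∧ Q * (2 * η) ≤ ε / 4 := by
    refine ⟨min (t₀ / 2) (ε / (8 * (Q + 1))), lt_min (by linarith [ht₀.1]) (by positivity),
      min_le_left _ _, ?_⟩
    have h1 : min (t₀ / 2) (ε / (8 * (Q + 1))) ≤ ε / (8 * (Q + 1)) := min_le_right _ _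
    rw [le_div_iff₀ (by positivity)] at h1
    have h2 : 0 < min (t₀ / 2) (ε / (8 * (Q + 1))) := lt_min (by linarith [ht₀.1]) (by positivity)
    nlinarith
  set a := t₀ - η with ha
  have ha0 : 0 < a := by linarith [ht₀.1]
  set φ : Space N → ℝ≥0∞ := fun y => ENNReal.ofReal (u a y) with hφ
  have hφm : Measurable φ := (hu.comp measurable_prodMk_left).ennreal_ofReal
  have hφM : ∀ y, φ y ≤ ENNReal.ofReal M := fun y =>
    ENNReal.ofReal_le_ofReal (hM a (by linarith) (by linarith [ht₀.2]) y)
  have hnear : ∀ t, a < t → t < T → t < t₀ + η → ∀ x,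
      (heatOp (t - a) φ x).toReal ≤ u t x ∧ u t x ≤ (heatOp (t - a) φ x).toReal + ε / 4 := by
    intro t hat htT htη x
    have h1 := duhamel_restart hf hu₀ hu hu0 heq ha0 hat htT x
    have hfin : heatOp (t - a) φ x ≠ ∞ :=
      ((heatOp_le hφM (by linarith) x).trans_lt ENNReal.ofReal_lt_top).ne
    have hI : ∫⁻ s in Ico a t, heatOp (t - s) (fun y => ENNReal.ofReal (f (u s y))) x
        ≤ ENNReal.ofReal (ε / 4) := by
      calc _ ≤ ∫⁻ s in Ico a t, ENNReal.ofReal Q := by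
            refine setLIntegral_mono' measurableSet_Ico fun s hs => ?_
            exact heatOp_le (fun y => ENNReal.ofReal_le_ofReal
              (hfQ s (by linarith [hs.1]) (hs.2.trans htT) y)) (by linarith [hs.2]) x
        _ = ENNReal.ofReal (Q * (t - a)) := by
            rw [setLIntegral_const, Real.volume_Ico, ← ENNReal.ofReal_mul hQ0]
        _ ≤ ENNReal.ofReal (ε / 4) := by
            refine ENNReal.ofReal_le_ofReal (le_trans ?_ hη2)
            exact mul_le_mul_of_nonneg_left (by linarith) hQ0
    constructor
    · refine ENNReal.toReal_le_of_le_ofReal (hu0 t x) ?_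
      rw [h1]; exact le_self_add
    · refine (ENNReal.ofReal_le_ofReal_iff (by positivity)).1 ?_
      rw [h1, ENNReal.ofReal_add ENNReal.toReal_nonneg (by positivity), ENNReal.ofReal_toReal hfin]
      gcongr
  -- The elapsed times `t - a` and `η = t₀ - a` come in either order; `min` and `max` cover both.
  have hcont : ∀ᶠ t in 𝓝 t₀, M * (1 - (min (t - a) η / max (t - a) η) ^ ((N : ℝ) / 2)) < ε / 4 := by
    have hc : ContinuousAt (fun t =>
        M * (1 - (min (t - a) η / max (t - a) η) ^ ((N : ℝ) / 2))) t₀ := by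
      have hne : max (t₀ - a) η ≠ 0 := (lt_max_of_lt_right hη0).ne'
      refine ContinuousAt.const_mul (continuousAt_const.sub (ContinuousAt.rpow_const ?_ (Or.inr (by positivity)))) M
      exact ContinuousAt.div (by fun_prop) (by fun_prop) hne
    refine hc.eventually (gt_mem_nhds ?_)
    beta_reduce
    rw [show t₀ - a = η by rw [ha]; ring, min_self, max_self, div_self hη0.ne', Real.one_rpow]
    simpa using hε
  filter_upwards [hcont, Ioo_mem_nhds (show a < t₀ by linarith) (show t₀ < t₀ + η by linarith),
    Iio_mem_nhds ht₀.2] with t h1 h2 h3 x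
  have hta := hnear t h2.1 h3 h2.2 x
  have htb := hnear t₀ (by linarith) ht₀.2 (by linarith) x
  rw [show t₀ - a = η by rw [ha]; ring] at htb
  have hdiff : |(heatOp (t - a) φ x).toReal - (heatOp η φ x).toReal| ≤ ε / 4 := by
    rcases le_total (t - a) η with h | h
    · rw [min_eq_left h, max_eq_right h] at h1
      rw [abs_sub_comm]
      exact (heatOp_time_le hφm hM0 hφM (by linarith [h2.1]) h x).trans h1.le
    · rw [min_eq_right h, max_eq_left h] at h1
      exact (heatOp_time_le hφm hM0 hφM hη0 h x).trans h1.le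
  rw [abs_le] at hdiff ⊢
  constructor <;> linarith [hta.1, hta.2, htb.1, htb.2, hdiff.1, hdiff.2]

/-- `L^∞` is not separable in general, so strong measurability does not follow from joint
measurability; it is obtained from norm continuity in time. -/
theorem exists_stronglyMeasurable_Lp (hu : Measurable (Function.uncurry u))
    (hu0 : ∀ t x, 0 ≤ u t x)
    (hbd : ∀ a, 0 < a → ∃ M, ∀ t, a ≤ t → t < T → ∀ x, u t x ≤ M)
    (hcont : ∀ t₀ ∈ Ioo 0 T, ∀ ε > 0, ∀ᶠ t in 𝓝 t₀, ∀ x, |u t x - u t₀ x| ≤ ε) :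
    ∃ U : ℝ → Lp ℝ ∞ (volume : Measure (Space N)),
      AEStronglyMeasurable U (volume.restrict (Ioo 0 T)) ∧ ∀ t ∈ Ioo 0 T, ⇑(U t) =ᵐ[volume] u t := by
  have hmem : ∀ t ∈ Ioo 0 T, MemLp (u t) ∞ (volume : Measure (Space N)) := fun t ht => by
    obtain ⟨M, hM⟩ := hbd t ht.1
    refine memLp_top_of_bound (hu.comp measurable_prodMk_left).aestronglyMeasurable M
      (ae_of_all _ fun x => ?_)
    rw [Real.norm_of_nonneg (hu0 t x)]
    exact hM t le_rfl ht.2 x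
  classical
  set U : ℝ → Lp ℝ ∞ (volume : Measure (Space N)) := fun t =>
    if ht : t ∈ Ioo 0 T then (hmem t ht).toLp (u t) else 0 with hU
  have hUt : ∀ t (ht : t ∈ Ioo 0 T), U t = (hmem t ht).toLp (u t) := fun t ht => by
    simp only [hU, dif_pos ht]
  refine ⟨U, ContinuousOn.aestronglyMeasurable ?_ measurableSet_Ioo, fun t ht => ?_⟩
  · refine fun t₀ ht₀ => ContinuousAt.continuousWithinAt ?_
    rw [Metric.continuousAt_iff']
    intro ε hε
    filter_upwards [hcont t₀ ht₀ (ε / 2) (by linarith), Ioo_mem_nhds ht₀.1 ht₀.2] with t h1 ht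
    rw [hUt t ht, hUt t₀ ht₀, dist_eq_norm, ← MemLp.toLp_sub, Lp.norm_toLp]
    refine lt_of_le_of_lt (ENNReal.toReal_le_of_le_ofReal (by linarith) ?_) (half_lt_self hε)
    rw [eLpNorm_exponent_top]
    exact eLpNormEssSup_le_of_ae_bound (ae_of_all _ fun x => h1 x)
  · rw [hUt t ht]
    exact (hmem t ht).coeFn_toLp

end TimeContinuity

/-! ### Choice of the parameters, and bounds for the solution. -/

section Existence

variable {N : ℕ} {q : ℝ} {f : ℝ → ℝ} {r u₁ δ T : ℝ} {u₀ g : Space N → ℝ}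

theorem tailFPow_nonneg (f : ℝ → ℝ) (r u : ℝ) : 0 ≤ tailFPow f r u := ENNReal.toReal_nonneg

theorem ulNormE_mono_ae {φ ψ : Space N → ℝ≥0∞} (h : φ ≤ᵐ[volume] ψ) : ulNormE φ ≤ ulNormE ψ :=
  iSup_mono fun y => lintegral_mono_ae (ae_restrict_of_ae (s := Metric.ball y 1) h)

theorem ulNormE_congr_ae {φ ψ : Space N → ℝ≥0∞} (h : φ =ᵐ[volume] ψ) : ulNormE φ = ulNormE ψ :=
  le_antisymm (ulNormE_mono_ae h.le) (ulNormE_mono_ae h.symm.le)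

theorem ulNormE_const_add_mul_le (a : ℝ≥0∞) {b : ℝ≥0∞} (hb : b ≠ ∞) (φ : Space N → ℝ≥0∞) :
    ulNormE (fun x => a + b * φ x) ≤
      a * volume (Metric.ball (0 : Space N) 1) + b * ulNormE φ := by
  refine iSup_le fun y => ?_
  rw [lintegral_add_left measurable_const, setLIntegral_const, Measure.addHaar_ball_center,
    lintegral_const_mul' _ _ hb]
  exact add_le_add_right (mul_le_mul_right
    (le_iSup (fun y : Space N => ∫⁻ x in Metric.ball y 1, φ x) y) _) _

/-- The solution of the heat equation with initial data `g`. -/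
noncomputable def heatFlow (g : Space N → ℝ) (t : ℝ) (x : Space N) : ℝ :=
  (heatOp t (fun y => ENNReal.ofReal (g y)) x).toReal

theorem heatFlow_nonneg (g : Space N → ℝ) (t : ℝ) (x : Space N) : 0 ≤ heatFlow g t x :=
  ENNReal.toReal_nonneg

theorem exists_mul_rpow_le (M : ℝ) {p c : ℝ} (hp : 0 < p) (hc : 0 < c) :
    ∃ T : ℝ, 0 < T ∧ T ≤ 1 ∧ M * T ^ p ≤ c := by
  have hcont : ContinuousAt (fun T : ℝ => M * T ^ p) 0 :=
    (Real.continuousAt_rpow_const 0 p (Or.inr hp.le)).const_mul M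
  have h0 : ∀ᶠ T in 𝓝 (0 : ℝ), M * T ^ p < c := by
    refine hcont.eventually (gt_mem_nhds ?_)
    beta_reduce
    rwa [Real.zero_rpow hp.ne', mul_zero]
  have h1 : ∀ᶠ T in 𝓝[>] (0 : ℝ), T < 1 := mem_nhdsWithin_of_mem_nhds (Iio_mem_nhds one_pos)
  obtain ⟨T, ⟨hT, hT1⟩, hT0⟩ :=
    (((h0.filter_mono nhdsWithin_le_nhds).and h1).and self_mem_nhdsWithin).exists
  exact ⟨T, hT0, hT1.le, hT.le⟩

/-- The function `g` is `F(u₀)^{-r} + F(u₁)^{-r}`, up to a null set. -/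
structure IsShiftedData (f : ℝ → ℝ) (r u₁ : ℝ) (u₀ g : Space N → ℝ) : Prop where
  measurable : Measurable g
  le : ∀ x, tailR f u₁ ^ (-r) ≤ g x
  ae_eq : ∀ᵐ x ∂(volume : Measure (Space N)), g x = tailFPow f r (u₀ x) + tailR f u₁ ^ (-r)
  ulNormE_lt : ulNormE (fun y => ENNReal.ofReal (g y)) < ∞

theorem exists_isShiftedData (f : ℝ → ℝ) (r u₁ : ℝ) {u₀ : Space N → ℝ}
    (h : MemL1ul fun x => tailFPow f r (u₀ x)) : ∃ g, IsShiftedData f r u₁ u₀ g := by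
  have hm := h.1.aemeasurable
  -- The maximum makes the lower bound by `F(u₁)^{-r}` hold everywhere and not only almost
  -- everywhere.
  have hae : ∀ᵐ x ∂(volume : Measure (Space N)), max (hm.mk _ x) 0 + tailR f u₁ ^ (-r)
      = tailFPow f r (u₀ x) + tailR f u₁ ^ (-r) := by
    filter_upwards [hm.ae_eq_mk] with x hx
    rw [← hx, max_eq_left (tailFPow_nonneg f r _)]
  refine ⟨fun x => max (hm.mk _ x) 0 + tailR f u₁ ^ (-r), (hm.measurable_mk.max
    measurable_const).add_const _, fun x => le_add_of_nonneg_left (le_max_right _ _), hae, ?_⟩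
  refine lt_of_le_of_lt (ulNormE_mono_ae (ψ := fun x => ENNReal.ofReal (tailR f u₁ ^ (-r)) +
    1 * ‖tailFPow f r (u₀ x)‖ₑ) ?_) ((ulNormE_const_add_mul_le _ ENNReal.one_ne_top _).trans_lt ?_)
  · filter_upwards [hae] with x hx
    rw [hx, one_mul, add_comm, Real.enorm_of_nonneg (tailFPow_nonneg f r _)]
    exact ENNReal.ofReal_add_le
  · rw [one_mul]
    exact ENNReal.add_lt_top.2 ⟨ENNReal.mul_lt_top ENNReal.ofReal_lt_top measure_ball_lt_top, h.2⟩

namespace IsShiftedData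

theorem measurable_ofReal (hg : IsShiftedData f r u₁ u₀ g) :
    Measurable fun y => ENNReal.ofReal (g y) := hg.measurable.ennreal_ofReal

theorem measurable_heatFlow (hg : IsShiftedData f r u₁ u₀ g) :
    Measurable (Function.uncurry (heatFlow g)) :=
  (measurable_heatOp_comp (φ := fun _ y => ENNReal.ofReal (g y)) measurable_fst measurable_snd
    (hg.measurable_ofReal.comp measurable_snd)).ennreal_toReal

theorem exists_heatFlow_le (hg : IsShiftedData f r u₁ u₀ g) : ∃ D : ℝ, 0 < D ∧
    (∀ t, 0 < t → t ≤ 1 → ∀ x,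
      heatOp t (fun y => ENNReal.ofReal (g y)) x = ENNReal.ofReal (heatFlow g t x)) ∧
    ∀ t, 0 < t → t ≤ 1 → ∀ x, heatFlow g t x ≤ D * t ^ (-(N : ℝ) / 2) := by
  obtain ⟨C, hC, h⟩ := exists_heatOp_le_ulNormE N
  set D := (ulNormE (fun y => ENNReal.ofReal (g y))).toReal with hD
  have hDE : ulNormE (fun y => ENNReal.ofReal (g y)) = ENNReal.ofReal D :=
    (ENNReal.ofReal_toReal hg.ulNormE_lt.ne).symm
  have hD0 : 0 ≤ D := ENNReal.toReal_nonneg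
  have hle : ∀ t, 0 < t → t ≤ 1 → ∀ x, heatOp t (fun y => ENNReal.ofReal (g y)) x ≤
      ENNReal.ofReal ((C * D + 1) * t ^ (-(N : ℝ) / 2)) := fun t ht ht1 x => by
    have htp : 0 < t ^ (-(N : ℝ) / 2) := Real.rpow_pos_of_pos ht _
    refine (h _ hg.measurable_ofReal t ht ht1 x).trans ?_
    rw [hDE, ← ENNReal.ofReal_mul (by positivity)]
    exact ENNReal.ofReal_le_ofReal (by nlinarith)
  refine ⟨C * D + 1, by positivity, fun t ht ht1 x => ?_, fun t ht ht1 x => ?_⟩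
  · exact (ENNReal.ofReal_toReal ((hle t ht ht1 x).trans_lt ENNReal.ofReal_lt_top).ne).symm
  · have htp : 0 < t ^ (-(N : ℝ) / 2) := Real.rpow_pos_of_pos ht _
    exact ENNReal.toReal_le_of_le_ofReal (by positivity) (hle t ht ht1 x)

theorem ofReal_heatFlow (hg : IsShiftedData f r u₁ u₀ g) {t : ℝ} (ht : 0 < t) (ht1 : t ≤ 1)
    (x : Space N) :
    heatOp t (fun y => ENNReal.ofReal (g y)) x = ENNReal.ofReal (heatFlow g t x) := by
  obtain ⟨D, -, h, -⟩ := hg.exists_heatFlow_le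
  exact h t ht ht1 x

theorem le_heatFlow (hg : IsShiftedData f r u₁ u₀ g) {t : ℝ} (ht : 0 < t) (ht1 : t ≤ 1)
    (x : Space N) : tailR f u₁ ^ (-r) ≤ heatFlow g t x := by
  refine (ENNReal.ofReal_le_ofReal_iff ENNReal.toReal_nonneg).1 ?_
  exact (le_heatOp (fun y => ENNReal.ofReal_le_ofReal (hg.le y)) ht x).trans_eq
    (hg.ofReal_heatFlow ht ht1 x)

theorem heatOp_heatFlow (hg : IsShiftedData f r u₁ u₀ g) (hT1 : T ≤ 1) :
    ∀ s ∈ Ioo 0 T, ∀ h, 0 < h → s + h < T → ∀ x,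
      heatOp h (fun y => ENNReal.ofReal (heatFlow g s y)) x
        = ENNReal.ofReal (heatFlow g (s + h) x) := by
  intro s hs h hh hsh x
  have h1 : (fun y => ENNReal.ofReal (heatFlow g s y))
      = heatOp s (fun y => ENNReal.ofReal (g y)) :=
    funext fun y => (hg.ofReal_heatFlow hs.1 (hs.2.le.trans hT1) y).symm
  rw [h1, heatOp_heatOp hg.measurable_ofReal hs.1 hh,
    ← hg.ofReal_heatFlow (by linarith [hs.1]) (by linarith), add_comm]

/-- The initial data lie below the initial value of the supersolution. -/
theorem le_profile (hg : IsShiftedData f r u₁ u₀ g) (hf : MemX q f)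
    (hc : ConvexAbove f r u₁ δ) :
    ∀ᵐ y ∂(volume : Measure (Space N)), u₀ y ≤ profile f r u₁ 1 0 (g y) := by
  filter_upwards [hg.ae_eq] with y hy
  -- Below `u₁` nothing is to prove, as the profile never falls below `u₁`. Above it, `g ≥
  -- F(u₀)^{-r}` gives `g^{-1/r} ≤ F(u₀)`.
  rcases le_total (u₀ y) u₁ with h | h
  · exact h.trans (le_invTail _ _ _)
  have hu := hc.u₁_pos.trans_le h
  have hF := hf.tailR_pos hu
  have hF1 : 0 < tailR f u₁ ^ (-r) := Real.rpow_pos_of_pos (hf.tailR_pos hc.u₁_pos) _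
  have hadm : Admissible f r u₁ δ 1 0 (g y) := ⟨one_pos, le_rfl, le_rfl, hg.le y, by
    rw [zero_mul, one_mul]
    exact mul_nonneg hc.δ_nonneg (Real.rpow_nonneg (hF1.le.trans (hg.le y)) _)⟩
  refine hf.le_of_tailR_le (hc.profile_pos _ _ _) hu ?_
  rw [hadm.tailR_profile hf hc, one_mul, sub_zero, hy, tailFPow_eq]
  refine (Real.rpow_le_rpow_of_nonpos (Real.rpow_pos_of_pos hF _) (le_add_of_nonneg_right hF1.le)
    (by simpa using hc.r_pos.le)).trans_eq ?_
  rw [← Real.rpow_mul hF.le, neg_mul_neg, mul_inv_cancel₀ hc.r_pos.ne', Real.rpow_one]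

end IsShiftedData

/-- All bounds come from `u ≤ v`, `F(v)^{-r} ≤ K w` and `v ≤ u₁ + B F(v)^{-r}`: smoothing of `w`
gives local boundedness, and the contraction of the uniformly local norm by the heat flow gives the
other two. -/
theorem exists_solution_of_superData (hf : MemX q f) (hu₀ : AEMeasurable u₀ volume)
    (hc : ConvexAbove f r u₁ δ) (hg : IsShiftedData f r u₁ u₀ g) {a b : ℝ → ℝ} (hT1 : T ≤ 1)
    (hs : SuperData f r u₁ δ T a b (heatFlow g)) :
    ∃ u : ℝ → Space N → ℝ, IsNonnegSolution f u₀ T u ∧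
      ∃ C : ℝ, 0 < C ∧ ∀ t ∈ Ioo 0 T,
        ulNorm (fun x => tailFPow f r (u t x)) ≤ ENNReal.ofReal C := by
  set v : ℝ → Space N → ℝ := fun s x => profile f r u₁ (a s) (b s) (heatFlow g s x) with hv
  have hv1 : ∀ s x, u₁ ≤ v s x := fun s x => le_invTail _ _ _
  have hvpos : ∀ s x, 0 < v s x := fun s x => hc.u₁_pos.trans_le (hv1 s x)
  have hv0 : ∀ s x, 0 ≤ v s x := fun s x => (hvpos s x).le
  have hvm : ∀ s, Measurable (v s) := fun s =>
    (hs.measurable_profile hf hc.u₁_pos).comp measurable_prodMk_left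
  have hF1 : 0 < tailR f u₁ ^ (-r) := Real.rpow_pos_of_pos (hf.tailR_pos hc.u₁_pos) _
  have hmk : Measurable fun y => ENNReal.ofReal (hu₀.mk u₀ y) := hu₀.measurable_mk.ennreal_ofReal
  have hmk' : ∀ (τ : ℝ) (y : Space N), heatOp τ (fun y => ENNReal.ofReal (u₀ y)) y
      = heatOp τ (fun y => ENNReal.ofReal (hu₀.mk u₀ y)) y := fun τ y =>
    heatOp_congr_ae (hu₀.ae_eq_mk.fun_comp ENNReal.ofReal) _ _
  have hinit : ∀ s ∈ Ioo 0 T, ∀ x,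
      heatOp s (fun y => ENNReal.ofReal (hu₀.mk u₀ y)) x ≤ ENNReal.ofReal (v s x) := by
    intro s hsT x
    have hy := hs.adm_self hsT x
    have hadm : ∀ y, tailR f u₁ ^ (-r) ≤ y → Admissible f r u₁ δ 1 0 y := fun y hy =>
      ⟨one_pos, le_rfl, le_rfl, hy, by
        rw [zero_mul, one_mul]
        exact mul_nonneg hc.δ_nonneg (Real.rpow_nonneg (hF1.le.trans hy) _)⟩
    -- Jensen's inequality is used with the initial parameters `a = 1`, `b = 0`; the profile at time
    -- `s` is larger because `a w^{-1/r} - b ≤ w^{-1/r}`.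
    have hm := hadm _ hy.le_y
    rw [← hmk']
    refine (heatOp_mono_ae ((hg.le_profile hf hc).mono fun y hy =>
      ENNReal.ofReal_le_ofReal hy) s x).trans ((heatOp_profile_le hf hc hsT.1 hg.measurable
        (fun y => hadm _ (hg.le y)) hm x
        (hg.ofReal_heatFlow hsT.1 (hsT.2.le.trans hT1) x)).trans (ENNReal.ofReal_le_ofReal ?_))
    refine hf.le_of_tailR_le (hvpos s x) (hc.profile_pos _ _ _) ?_
    rw [hm.tailR_profile hf hc, hy.tailR_profile hf hc]
    have h3 : 0 ≤ heatFlow g s x ^ (-r⁻¹) := Real.rpow_nonneg (hy.y_pos hf hc).le _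
    nlinarith [hy.a_le, hy.b_nonneg]
  have hduh : ∀ t ∈ Ioo 0 T, ∀ x, duhamel f u₀ v t x ≤ ENNReal.ofReal (v t x) := by
    intro t ht x
    rw [duhamel_eq, hmk']
    exact duhamel_le_of_step (g := fun s y => f (v s y)) hvm
      (fun s => hf.measurable_comp (hvm s) (hv0 s)) hv0 (fun s y => hf.nonneg (hv0 s y)) hinit hmk
      (fun s hsT h hh hsh x => hs.profile_mono hf hc hsT hh hsh x)
      (fun s hsT => hs.profile_step hf hc hsT) ht x
  obtain ⟨u, hum, hu0, huv, hueq⟩ := exists_solution_of_supersolution hf hu₀ hv0 hduh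
  obtain ⟨B, hB0, hB⟩ := hc.exists_le_add_mul hf
  obtain ⟨D, hD0, -, hD⟩ := hg.exists_heatFlow_le
  set K : ℝ := (2 * (1 + δ)) ^ r with hK
  have hK0 : 0 ≤ K := Real.rpow_nonneg (by linarith [hc.δ_nonneg]) _
  have hvK : ∀ t ∈ Ioo 0 T, ∀ x, tailR f (v t x) ^ (-r) ≤ K * heatFlow g t x := fun t ht x =>
    (hs.adm_self ht x).tailR_profile_rpow_le hf hc (hs.half_le t ht)
  have huw : ∀ t ∈ Ioo 0 T, ∀ x, u t x ≤ u₁ + B * K * heatFlow g t x := fun t ht x => by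
    have h1 := hB _ (hv1 t x)
    have h2 := mul_le_mul_of_nonneg_left (hvK t ht x) hB0
    linarith [huv t ht x]
  have hbd : ∀ a, 0 < a → ∃ M, ∀ t, a ≤ t → t < T → ∀ x, u t x ≤ M := by
    intro a ha
    refine ⟨u₁ + B * K * (D * a ^ (-(N : ℝ) / 2)), fun t hat htT x => ?_⟩
    have ht0 := ha.trans_le hat
    refine (huw t ⟨ht0, htT⟩ x).trans (add_le_add_right (mul_le_mul_of_nonneg_left ?_
      (mul_nonneg hB0 hK0)) _)
    refine (hD t ht0 (htT.le.trans hT1) x).trans (mul_le_mul_of_nonneg_left ?_ hD0.le)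
    have hN : 0 ≤ (N : ℝ) := Nat.cast_nonneg N
    exact Real.rpow_le_rpow_of_nonpos ha hat (by linarith)
  set W := ulNormE (fun y => ENNReal.ofReal (g y)) with hW
  have hul : ∀ t ∈ Ioo 0 T, ∀ (ψ : Space N → ℝ) (A E : ℝ), 0 ≤ A → 0 ≤ E → (∀ x, 0 ≤ ψ x) →
      (∀ x, ψ x ≤ A + E * heatFlow g t x) → ulNorm ψ ≤ ENNReal.ofReal A *
        volume (Metric.ball (0 : Space N) 1) + ENNReal.ofReal E * W := by
    intro t ht ψ A E hA hE hψ0 hψ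
    calc ulNorm ψ ≤ ulNormE (fun x => ENNReal.ofReal A + ENNReal.ofReal E *
          heatOp t (fun y => ENNReal.ofReal (g y)) x) := by
          refine iSup_mono fun y => lintegral_mono fun x => ?_
          rw [Real.enorm_of_nonneg (hψ0 x), hg.ofReal_heatFlow ht.1 (ht.2.le.trans hT1),
            ← ENNReal.ofReal_mul hE,
            ← ENNReal.ofReal_add hA (mul_nonneg hE (heatFlow_nonneg g t x))]
          exact ENNReal.ofReal_le_ofReal (hψ x)
      _ ≤ ENNReal.ofReal A * volume (Metric.ball (0 : Space N) 1) + ENNReal.ofReal E *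
          ulNormE (heatOp t (fun y => ENNReal.ofReal (g y))) :=
          ulNormE_const_add_mul_le _ ENNReal.ofReal_ne_top _
      _ ≤ _ := add_le_add_right (mul_le_mul_right
          (ulNormE_heatOp_le hg.measurable_ofReal ht.1) _) _
  have hfin : ∀ A E : ℝ, ENNReal.ofReal A * volume (Metric.ball (0 : Space N) 1) +
      ENNReal.ofReal E * W ≠ ∞ := fun A E => (ENNReal.add_lt_top.2
    ⟨ENNReal.mul_lt_top ENNReal.ofReal_lt_top measure_ball_lt_top,
      ENNReal.mul_lt_top ENNReal.ofReal_lt_top hg.ulNormE_lt⟩).ne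
  refine ⟨u, ⟨fun t _ x => hu0 t x, hum.aemeasurable, ?_, ?_, ?_, ?_⟩, ?_⟩
  · exact exists_stronglyMeasurable_Lp hum hu0 hbd fun t₀ ht₀ ε hε =>
      exists_uniform_modulus hf hu₀ hum hu0 hueq hbd ht₀ hε
  · refine ⟨(ENNReal.ofReal u₁ * volume (Metric.ball (0 : Space N) 1) +
      ENNReal.ofReal (B * K) * W).toReal, fun t ht => ?_⟩
    rw [ENNReal.ofReal_toReal (hfin _ _)]
    exact hul t ht _ _ _ hc.u₁_pos.le (mul_nonneg hB0 hK0) (hu0 t) (huw t ht)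
  · intro α β hα hβ
    obtain ⟨M, hM⟩ := hbd α hα
    refine ⟨M, fun t ht => ?_⟩
    rw [eLpNorm_exponent_top]
    refine eLpNormEssSup_le_of_ae_bound (ae_of_all _ fun x => ?_)
    rw [Real.norm_of_nonneg (hu0 t x)]
    exact hM t ht.1 (ht.2.trans_lt hβ) x
  · exact fun t ht => ae_of_all _ fun x => hueq t ht x
  · refine ⟨(ENNReal.ofReal 0 * volume (Metric.ball (0 : Space N) 1) +
      ENNReal.ofReal K * W).toReal + 1, by positivity, fun t ht => ?_⟩
    refine le_trans ?_ (ENNReal.ofReal_le_ofReal (le_add_of_nonneg_right zero_le_one))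
    rw [ENNReal.ofReal_toReal (hfin _ _)]
    refine hul t ht _ _ _ le_rfl hK0 (fun x => ENNReal.toReal_nonneg) fun x => ?_
    rw [zero_add]
    refine le_trans ?_ (hvK t ht x)
    rw [← tailFPow_eq]
    exact hf.tailFPow_mono hc.r_pos.le (hvpos t x) (huv t ht x)

/-- As `w^{-1/r} ≥ c s^θ`, the requirement `-a' w^{-1/r} ≥ 1` is met by `-a'` of order `s^{-θ}`,
integrable at `0` since `θ < 1`. With `b = 0` no slack in the convexity condition is spent, so `q =
1 + r` is allowed. -/
theorem exists_superData_subcritical (hf : MemX q f) (hN : (N : ℝ) / 2 < r)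
    (hc : ConvexAbove f r u₁ 0) (hg : IsShiftedData f r u₁ u₀ g) :
    ∃ T a b, 0 < T ∧ T ≤ 1 ∧ SuperData f r u₁ 0 T a b (heatFlow g) := by
  obtain ⟨D, hD0, -, hD⟩ := hg.exists_heatFlow_le
  have hr := hc.r_pos
  set θ : ℝ := (N : ℝ) / 2 / r with hθ
  have hθ1 : θ < 1 := (div_lt_one hr).2 hN
  have h1θ : 0 < 1 - θ := by linarith
  set c : ℝ := D ^ (-r⁻¹) with hcdef
  have hc0 : 0 < c := Real.rpow_pos_of_pos hD0 _
  have hF1 : 0 < tailR f u₁ ^ (-r) := Real.rpow_pos_of_pos (hf.tailR_pos hc.u₁_pos) _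
  have hw : ∀ t, 0 < t → t ≤ 1 → ∀ x, c * t ^ θ ≤ heatFlow g t x ^ (-r⁻¹) := by
    intro t ht ht1 x
    refine le_trans (le_of_eq ?_) (Real.rpow_le_rpow_of_nonpos
      (hF1.trans_le (hg.le_heatFlow ht ht1 x)) (hD t ht ht1 x) (by simpa using hr.le))
    rw [Real.mul_rpow hD0.le (by positivity), ← Real.rpow_mul ht.le]
    congr 2
    rw [hθ]; field_simp
  -- Makes `-a'(s) = 2 s^{-θ} / c`, twice what is needed; the strict inequality passes to difference
  -- quotients for small `h`.
  set A : ℝ := 2 / (c * (1 - θ)) with hA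
  have hA0 : 0 < A := by positivity
  obtain ⟨T, hT0, hT1, hTA⟩ : ∃ T : ℝ, 0 < T ∧ T ≤ 1 ∧ A * T ^ (1 - θ) ≤ 1 / 2 :=
    exists_mul_rpow_le A h1θ (by norm_num)
  have hmonoP : ∀ s s' : ℝ, 0 ≤ s → s ≤ s' → A * s ^ (1 - θ) ≤ A * s' ^ (1 - θ) :=
    fun s s' h0 h => mul_le_mul_of_nonneg_left (Real.rpow_le_rpow h0 h h1θ.le) hA0.le
  have hahalf : ∀ s ∈ Ioo 0 T, 1 / 2 ≤ 1 - A * s ^ (1 - θ) := fun s hs => by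
    linarith [hmonoP s T hs.1.le hs.2.le]
  have hadm : ∀ s ∈ Ioo 0 T, ∀ y, tailR f u₁ ^ (-r) ≤ y →
      Admissible f r u₁ 0 (1 - A * s ^ (1 - θ)) 0 y := fun s hs y hy => by
    have := hahalf s hs
    have hs0 : 0 ≤ s ^ (1 - θ) := Real.rpow_nonneg hs.1.le _
    exact ⟨by linarith, by nlinarith, le_rfl, hy, by simp⟩
  refine ⟨T, fun s => 1 - A * s ^ (1 - θ), fun _ => 0, hT0, hT1, hg.measurable_heatFlow,
    by fun_prop, measurable_const, hg.heatOp_heatFlow hT1, hahalf, ?_, fun _ _ _ _ _ => le_rfl,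
    ?_, ?_⟩
  · exact fun s hs s' _ hss' => by linarith [hmonoP s s' hs.1.le hss']
  · exact fun s hs h hh hsh x => hadm s hs _
      (hg.le_heatFlow (by linarith [hs.1]) (by linarith) x)
  · intro s hs
    have hsθ : 0 < s ^ (-θ) := Real.rpow_pos_of_pos hs.1 _
    have hder : HasDerivAt (fun s : ℝ => A * s ^ (1 - θ)) (A * ((1 - θ) * s ^ (-θ))) s := by
      have := (Real.hasDerivAt_rpow_const (p := 1 - θ) (Or.inl hs.1.ne')).const_mul A
      rwa [sub_sub_cancel_left] at this
    have hlim := (hasDerivAt_iff_tendsto_slope_zero.1 hder).mono_left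
      (nhdsWithin_mono (0 : ℝ) (show Ioi (0 : ℝ) ⊆ {0}ᶜ from fun h hh => (ne_of_gt hh)))
    have hAc : A * ((1 - θ) * s ^ (-θ)) = 2 * (s ^ (-θ) / c) := by
      rw [hA]; field_simp
    have hlt : s ^ (-θ) / c < A * ((1 - θ) * s ^ (-θ)) := by
      rw [hAc]
      have : 0 < s ^ (-θ) / c := by positivity
      linarith
    have hsmall : ∀ᶠ h in 𝓝[>] (0 : ℝ), h < T - s :=
      mem_nhdsWithin_of_mem_nhds (Iio_mem_nhds (by linarith [hs.2]))
    filter_upwards [hlim.eventually (lt_mem_nhds hlt), self_mem_nhdsWithin, hsmall]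
      with h h1 h2 h3 x
    have h2 : 0 < h := h2
    have hs1 := hs.2.le.trans hT1
    refine ⟨hadm (s + h) ⟨by linarith [hs.1], by linarith⟩ _ (hg.le_heatFlow hs.1 hs1 x), ?_⟩
    rw [smul_eq_mul, inv_mul_eq_div, lt_div_iff₀ h2] at h1
    have hws := hw s hs.1 hs1 x
    have h4 : s ^ (-θ) / c * h * (c * s ^ θ) = h := by
      have : s ^ (-θ) * s ^ θ = 1 := by
        rw [← Real.rpow_add hs.1, neg_add_cancel, Real.rpow_zero]
      calc _ = s ^ (-θ) * s ^ θ * h * (c / c) := by ring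
        _ = h := by rw [this, div_self hc0.ne']; ring
    have h5 : s ^ (-θ) / c * h * (c * s ^ θ) ≤
        (A * (s + h) ^ (1 - θ) - A * s ^ (1 - θ)) * heatFlow g s x ^ (-r⁻¹) := by
      have : 0 ≤ s ^ θ := Real.rpow_nonneg hs.1.le _
      refine mul_le_mul h1.le hws (by positivity) (le_trans (by positivity) h1.le)
    linarith

/-- For data in the closure of `BUC` the smoothing estimate improves to `o(t^{-N/2})`. -/
theorem IsShiftedData.exists_heatFlow_le_small (hf : MemX q f)
    (hg : IsShiftedData f r u₁ u₀ g) (hu₁ : 0 < u₁) (hN : 1 ≤ N)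
    (hBUC : MemClosureBUC fun x => tailFPow f r (u₀ x)) {ε : ℝ} (hε : 0 < ε) :
    ∃ T : ℝ, 0 < T ∧ T ≤ 1 ∧ ∀ t ∈ Ioo 0 T, ∀ x, heatFlow g t x ≤ ε * t ^ (-(N : ℝ) / 2) := by
  obtain ⟨C, hC, hsm⟩ := exists_heatOp_le_ulNormE N
  -- `g ≤ M + |F(u₀)^{-r} - ψ|`. The bounded part stays at most `M ≤ (ε/2) t^{-N/2}` for small `t`,
  -- and the smoothing constant `C` turns the remainder into another `(ε/2) t^{-N/2}`.
  obtain ⟨ψ, hψc, ⟨M', hM'⟩, hψ⟩ := hBUC.2 (ENNReal.ofReal (ε / (2 * C)))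
    (ENNReal.ofReal_pos.2 (by positivity))
  set M := max M' 0 + tailR f u₁ ^ (-r) with hMdef
  have hF1 : 0 < tailR f u₁ ^ (-r) := Real.rpow_pos_of_pos (hf.tailR_pos hu₁) _
  have hM0 : 0 < M := add_pos_of_nonneg_of_pos (le_max_right _ _) hF1
  have hdm : AEMeasurable (fun x => ‖tailFPow f r (u₀ x) - ψ x‖ₑ) (volume : Measure (Space N)) :=
    (hBUC.1.1.sub hψc.continuous.aestronglyMeasurable).enorm
  have hN0 : (0 : ℝ) < (N : ℝ) / 2 := by
    have : (1 : ℝ) ≤ N := by exact_mod_cast hN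
    linarith
  obtain ⟨T, hT0, hT1, hTM⟩ : ∃ T : ℝ, 0 < T ∧ T ≤ 1 ∧ M * T ^ ((N : ℝ) / 2) ≤ ε / 2 :=
    exists_mul_rpow_le M hN0 (by linarith)
  refine ⟨T, hT0, hT1, fun t ht x => ?_⟩
  have htp : 0 < t ^ (-(N : ℝ) / 2) := Real.rpow_pos_of_pos ht.1 _
  have ht1 := ht.2.le.trans hT1
  refine (ENNReal.ofReal_le_ofReal_iff (by positivity)).1 ?_
  rw [← hg.ofReal_heatFlow ht.1 ht1]
  calc heatOp t (fun y => ENNReal.ofReal (g y)) x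
      ≤ heatOp t (fun y => ENNReal.ofReal M + hdm.mk _ y) x := by
        refine heatOp_mono_ae ?_ _ _
        filter_upwards [hg.ae_eq, hdm.ae_eq_mk] with y hy hy'
        rw [← hy', Real.enorm_eq_ofReal_abs, hy, ← ENNReal.ofReal_add hM0.le (abs_nonneg _)]
        refine ENNReal.ofReal_le_ofReal ?_
        have h1 := le_abs_self (tailFPow f r (u₀ y) - ψ y)
        have h2 := (le_abs_self (ψ y)).trans (hM' y)
        have h3 := le_max_left M' 0
        linarith
    _ = ENNReal.ofReal M + heatOp t (hdm.mk _) x := by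
        rw [heatOp_add measurable_const, heatOp_const _ ht.1]
    _ ≤ ENNReal.ofReal M + ENNReal.ofReal (C * t ^ (-(N : ℝ) / 2)) *
          ENNReal.ofReal (ε / (2 * C)) := by
        refine add_le_add_right ((hsm _ hdm.measurable_mk t ht.1 ht1 x).trans
          (mul_le_mul_right ?_ _)) _
        rw [← ulNormE_congr_ae hdm.ae_eq_mk]
        exact hψ.le
    _ = ENNReal.ofReal (M + ε / 2 * t ^ (-(N : ℝ) / 2)) := by
        rw [← ENNReal.ofReal_mul (by positivity), ← ENNReal.ofReal_add hM0.le (by positivity)]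
        congr 2
        field_simp
    _ ≤ ENNReal.ofReal (ε * t ^ (-(N : ℝ) / 2)) := by
        refine ENNReal.ofReal_le_ofReal ?_
        have h1 : M * t ^ ((N : ℝ) / 2) ≤ ε / 2 := (mul_le_mul_of_nonneg_left
          (Real.rpow_le_rpow ht.1.le ht.2.le hN0.le) hM0.le).trans hTM
        have h2 : t ^ ((N : ℝ) / 2) * t ^ (-(N : ℝ) / 2) = 1 := by
          rw [← Real.rpow_add ht.1, show (N : ℝ) / 2 + -(N : ℝ) / 2 = 0 by ring, Real.rpow_zero]
        have h3 := mul_le_mul_of_nonneg_right h1 htp.le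
        rw [mul_assoc, h2, mul_one] at h3
        linarith

/-- Here `θ = 1` and `s^{-1}` is not integrable, so `a` stays constant and `b(s) = s` supplies the
unit drop exactly. Concavity then needs `s (1 + δ) ≤ δ w^{-1/r}`, which is where the smallness of
`t^{N/2} w` enters. -/
theorem exists_superData_critical (hf : MemX q f) (hN : 1 ≤ N) (hrN : r = (N : ℝ) / 2)
    (hδ : 0 < δ) (hc : ConvexAbove f r u₁ δ) (hg : IsShiftedData f r u₁ u₀ g)
    (hBUC : MemClosureBUC fun x => tailFPow f r (u₀ x)) :
    ∃ T a b, 0 < T ∧ T ≤ 1 ∧ SuperData f r u₁ δ T a b (heatFlow g) := by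
  have hr := hc.r_pos
  -- The factor `2` absorbs `b(s+h) = s + h ≤ 2s` when the later parameters meet the earlier `w(s)`.
  set K : ℝ := 2 * (1 + δ) / δ with hK
  have hK0 : 0 < K := by positivity
  have hKδ : δ * K = 2 * (1 + δ) := by rw [hK]; field_simp
  have hF1 : 0 < tailR f u₁ ^ (-r) := Real.rpow_pos_of_pos (hf.tailR_pos hc.u₁_pos) _
  -- With `ε = K^{-r}` and `N/2 = r` the bound reads `w ≤ (K t)^{-r}`, that is `w^{-1/r} ≥ K t`.
  obtain ⟨T, hT0, hT1, hT⟩ := hg.exists_heatFlow_le_small hf hc.u₁_pos hN hBUC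
    (Real.rpow_pos_of_pos hK0 (-r))
  have hw : ∀ t ∈ Ioo 0 T, ∀ x, K * t ≤ heatFlow g t x ^ (-r⁻¹) := by
    intro t ht x
    refine le_trans (le_of_eq ?_) (Real.rpow_le_rpow_of_nonpos
      (hF1.trans_le (hg.le_heatFlow ht.1 (ht.2.le.trans hT1) x)) (hT t ht x) (by simpa using hr.le))
    rw [neg_div, ← hrN, ← Real.mul_rpow hK0.le ht.1.le,
      ← Real.rpow_mul (mul_nonneg hK0.le ht.1.le), neg_mul_neg, mul_inv_cancel₀ hr.ne',
      Real.rpow_one]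
  refine ⟨T, fun _ => 1, fun s => s, hT0, hT1, hg.measurable_heatFlow, measurable_const,
    measurable_id, hg.heatOp_heatFlow hT1, fun _ _ => by norm_num, fun _ _ _ _ _ => le_rfl,
    fun _ _ _ _ h => h, ?_, ?_⟩
  · intro s hs h hh hsh x
    have hsh0 : 0 < s + h := by linarith [hs.1]
    refine ⟨one_pos, le_rfl, hs.1.le, hg.le_heatFlow hsh0 (by linarith) x, ?_⟩
    have h1 := mul_le_mul_of_nonneg_left (hw (s + h) ⟨hsh0, hsh⟩ x) hδ.le
    rw [← mul_assoc, hKδ] at h1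
    nlinarith [hs.1]
  · intro s hs
    have hsmall : ∀ᶠ h in 𝓝[>] (0 : ℝ), h < s :=
      mem_nhdsWithin_of_mem_nhds (Iio_mem_nhds hs.1)
    filter_upwards [hsmall, self_mem_nhdsWithin] with h h1 h2 x
    have h2 : 0 < h := h2
    refine ⟨⟨one_pos, le_rfl, by linarith [hs.1],
      hg.le_heatFlow hs.1 (hs.2.le.trans hT1) x, ?_⟩, by linarith⟩
    have h3 := mul_le_mul_of_nonneg_left (hw s hs x) hδ.le
    rw [← mul_assoc, hKδ] at h3
    nlinarith [hs.1]

theorem exists_convexAbove (hr : 0 < r)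
    (h : ∀ᶠ u in atTop, deriv f u * tailR f u * (1 + δ) ≤ 1 + r) (hδ : 0 ≤ δ) :
    ∃ u₁, ConvexAbove f r u₁ δ := by
  obtain ⟨U, hU⟩ := eventually_atTop.1 h
  exact ⟨max U 1, hr, lt_max_of_lt_right one_pos, hδ, fun z hz =>
    hU z ((le_max_left _ _).trans hz)⟩

theorem MemX.exists_delta (hf : MemX q f) (hr : 0 < r) (hq : q < 1 + r) :
    ∃ δ, 0 < δ ∧ ∀ᶠ u in atTop, deriv f u * tailR f u * (1 + δ) ≤ 1 + r := by
  have hq0 : 0 ≤ q := ge_of_tendsto hf.tendsto (by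
    filter_upwards [eventually_gt_atTop 0] with u hu
    exact mul_nonneg (hf.deriv_nonneg u hu) ENNReal.toReal_nonneg)
  have hq' : 0 < (q + (1 + r)) / 2 := by linarith
  -- Eventually `f' F` is below the midpoint of `q` and `1 + r`, and `1 + δ` is the ratio of `1 + r`
  -- to that midpoint.
  refine ⟨(1 + r) / ((q + (1 + r)) / 2) - 1, ?_, ?_⟩
  · rw [sub_pos, lt_div_iff₀ hq']
    linarith
  · filter_upwards [hf.tendsto.eventually (gt_mem_nhds (show q < (q + (1 + r)) / 2 by linarith))]
      with u hu
    have hu : deriv f u * tailR f u < (q + (1 + r)) / 2 := hu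
    rw [add_sub_cancel, mul_div_assoc', div_le_iff₀ hq', mul_comm]
    exact mul_le_mul_of_nonneg_left hu.le (by linarith)

end Existence

end SemilinearHeat

/-! ### The three cases of the theorem. -/

theorem theoremA (N : ℕ) (hN : 1 ≤ N) (f : ℝ → ℝ) (q r : ℝ) (hf : SemilinearHeat.MemX q f)
    (u₀ : SemilinearHeat.Space N → ℝ) (hu₀_meas : AEMeasurable u₀ volume)
    (hu₀ : ∀ᵐ x ∂(volume : Measure (SemilinearHeat.Space N)), 0 ≤ u₀ x)
    (hcases :
      ((N : ℝ) / 2 < r ∧ q < 1 + r ∧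
        SemilinearHeat.MemL1ul (fun x => SemilinearHeat.tailFPow f r (u₀ x))) ∨
      ((N : ℝ) / 2 < r ∧ q = 1 + r ∧
        (∀ᶠ u : ℝ in atTop, deriv f u * (SemilinearHeat.tailF f u).toReal ≤ q) ∧
        SemilinearHeat.MemL1ul (fun x => SemilinearHeat.tailFPow f r (u₀ x))) ∨
      (r = (N : ℝ) / 2 ∧ q < 1 + r ∧
        SemilinearHeat.MemClosureBUC (fun x => SemilinearHeat.tailFPow f r (u₀ x)))) :
    ∃ T : ℝ, 0 < T ∧ ∃ u : ℝ → SemilinearHeat.Space N → ℝ,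
      SemilinearHeat.IsNonnegSolution f u₀ T u ∧
      ∃ C : ℝ, 0 < C ∧ ∀ t ∈ Ioo 0 T,
        SemilinearHeat.ulNorm (fun x => SemilinearHeat.tailFPow f r (u t x))
          ≤ ENNReal.ofReal C := by

  have hr : 0 < r := by
    have h1 : (1 : ℝ) ≤ N := by exact_mod_cast hN
    rcases hcases with h | h | h
    · linarith [h.1]
    · linarith [h.1]
    · linarith [h.1]
  -- Cases (i) and (ii) share this argument: both give `f' F ≤ 1 + r` for large `u`, and slack `δ =
  -- 0` is enough.
  have hsub : ∀ h1 : (N : ℝ) / 2 < r,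
      (∀ᶠ u : ℝ in atTop, deriv f u * SemilinearHeat.tailR f u ≤ 1 + r) →
      SemilinearHeat.MemL1ul (fun x => SemilinearHeat.tailFPow f r (u₀ x)) →
      ∃ T : ℝ, 0 < T ∧ ∃ u : ℝ → SemilinearHeat.Space N → ℝ,
      SemilinearHeat.IsNonnegSolution f u₀ T u ∧
      ∃ C : ℝ, 0 < C ∧ ∀ t ∈ Ioo 0 T,
        SemilinearHeat.ulNorm (fun x => SemilinearHeat.tailFPow f r (u t x))
          ≤ ENNReal.ofReal C := by
    intro h1 h2 h3
    obtain ⟨u₁, hc⟩ := SemilinearHeat.exists_convexAbove (δ := 0) hr (by simpa using h2) le_rfl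
    obtain ⟨g, hg⟩ := SemilinearHeat.exists_isShiftedData f r u₁ h3
    obtain ⟨T, a, b, hT0, hT1, hs⟩ := SemilinearHeat.exists_superData_subcritical hf h1 hc hg
    exact ⟨T, hT0, SemilinearHeat.exists_solution_of_superData hf hu₀_meas hc hg hT1 hs⟩
  rcases hcases with ⟨h1, h2, h3⟩ | ⟨h1, h2, h3, h4⟩ | ⟨h1, h2, h3⟩
  · exact hsub h1 ((hf.tendsto.eventually (gt_mem_nhds h2)).mono fun u hu => le_of_lt hu) h3
  · exact hsub h1 (h3.mono fun u hu => le_of_le_of_eq hu h2) h4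
  · obtain ⟨δ, hδ, hev⟩ := hf.exists_delta hr h2
    obtain ⟨u₁, hc⟩ := SemilinearHeat.exists_convexAbove hr hev hδ.le
    obtain ⟨g, hg⟩ := SemilinearHeat.exists_isShiftedData f r u₁ h3.1
    obtain ⟨T, a, b, hT0, hT1, hs⟩ :=
      SemilinearHeat.exists_superData_critical hf hN h1 hδ hc hg h3
    exact ⟨T, hT0, SemilinearHeat.exists_solution_of_superData hf hu₀_meas hc hg hT1 hs⟩
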